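/- **Setting.** Let $f(x,y)=\frac1n\sum_{i=1}^n f_i(x,y)$ with $n\ge 1$, $x\in\mathbb R^{d_1}$, $y\in\mathbb R^{d_2}$. Each $f_i$ is continuously differentiable and, for a constant $l>0$, both partial gradients satisfy $$\|\nabla_x f_i(x_1,y_1)-\nabla_x f_i(x_2,y_2)\|\le l\,(\|x_1-x_2\|+\|y_1-y_2\|),\qquad \|\nabla_y f_i(x_1,y_1)-\nabla_y f_i(x_2,y_2)\|\le l\,(\|x_1-x_2\|+\|y_1-y_2\|).$$ Assume that $f$ has a saddle point, that $\min_x f(x,y)$ is attained for every $y$ and $\max_y f(x,y)$ is attained for every $x$, and that $f$ satisfies the two-sided PL condition with constants $\mu_1,\mu_2>0$: for all $x,y$, $$\|\nabla_xf(x,y)\|^2\ge 2\mu_1\big[f(x,y)-\min_{x'}f(x',y)\big],\qquad \|\nabla_yf(x,y)\|^2\ge 2\mu_2\big[\max_{y'}f(x,y')-f(x,y)\big].$$ Put $\kappa=l/\min(\mu_1,\mu_2)$, $g(x)=\max_y f(x,y)$ and $g^*=\min_x g(x)$. **Algorithm (VR-AGDA with stepsizes $\tau_1,\tau_2$, with $N$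 inner iterations and $T=1$).** Start from a deterministic point $(x^0,y^0)$. Epoch $k=0,1,2,\dots$: put $(\tilde x,\tilde y)=(x_0,y_0)=(x^k,y^k)$ and compute the full gradients $\nabla_xf(\tilde x,\tilde y)$, $\nabla_yf(\tilde x,\tilde y)$ from the $n$ components. For $j=0,\dots,N-1$ draw fresh independent indices $i^1_j,i^2_j$, uniform in $\{1,\dots,n\}$, and set $$x_{j+1}=x_j-\tau_1\big[\nabla_xf_{i^1_j}(x_j,y_j)-\nabla_xf_{i^1_j}(\tilde x,\tilde y)+\nabla_xf(\tilde x,\tilde y)\big],$$ $$y_{j+1}=y_j+\tau_2\big[\nabla_yf_{i^2_j}(x_{j+1},y_j)-\nabla_yf_{i^2_j}(\tilde x,\tilde y)+\nabla_yf(\tilde x,\tilde y)\big].$$ Finally choose $(x^{k+1},y^{k+1})$ uniformly at random from $\{(x_j,y_j)\}_{j=0}^{N-1}$. (If $N=0$, an epoch leaves its starting point unchanged.) The cost of a run is the number of partial gradients $\nabla_xf_i$, $\nabla_yf_i$ of components that are evaluated. Let $$P_k=\mathbb E[g(x^k)-g^*]+\tfrac1{20}\,\mathbb E[g(x^k)-f(x^k,y^k)].$$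 **Theorem.** There are absolute constants $\alpha,\beta,C>0$ (independent of $n,d_1,d_2,l,\mu_1,\mu_2$, of the functions and of the starting point) such that the following holds in the above setting for VR-AGDA with $T=1$, $$\tau_1=\frac{\beta}{28\kappa^8l},\qquad \tau_2=\frac{\beta}{l\kappa^6},\qquad N=\Big\lfloor \alpha\beta^{-2/3}\kappa^9\big(2+4\beta^{1/2}\kappa^{-3}\big)^{-1}\Big\rfloor,$$ and every starting point $(x^0,y^0)$. 1. $N\ge1$ unless $f$ is constant, and $P_{k+1}\le\frac12P_k$ for every $k\ge0$. 2. The total complexity for reaching an $\epsilon$-optimal solution is $O\big((n+\kappa^9)\log(1/\epsilon)\big)$. Precisely, for every $\epsilon>0$ there is a number $K$ of epochs such that $P_K\le\epsilon$ and the cost of the first $K$ epochs is, for every outcome of the random choices, at most $$C\,(n+\kappa^9)\,\big(1+\max\{0,\log(P_0/\epsilon)\}\big)$$ (where $\max\{0,\log(P_0/\epsilon)\}$ is read as $0$ if $P_0=0$). -/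

import Mathlib

noncomputable section

namespace VRAGDA

/-- Euclidean space of dimension `d`. -/
abbrev E (d : ℕ) : Type := EuclideanSpace ℝ (Fin d)

/-! ### The minimax problem -/

/-- The partial gradient with respect to the first variable. -/
def gradX {d₁ d₂ : ℕ} (h : E d₁ → E d₂ → ℝ) (x : E d₁) (y : E d₂) : E d₁ :=
  gradient (fun x' => h x' y) x

/-- The partial gradient with respect to the second variable. -/
def gradY {d₁ d₂ : ℕ} (h : E d₁ → E d₂ → ℝ) (x : E d₁) (y : E d₂) : E d₂ :=
  gradient (fun y' => h x y') y

/-- `h` is continuously differentiable with `l`-Lipschitz partial gradients. -/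
structure LipschitzGradient {d₁ d₂ : ℕ} (l : ℝ) (h : E d₁ → E d₂ → ℝ) : Prop where
  contDiff : ContDiff ℝ 1 (fun z : E d₁ × E d₂ => h z.1 z.2)
  gradX_le : ∀ x₁ x₂ y₁ y₂,
    ‖gradX h x₁ y₁ - gradX h x₂ y₂‖ ≤ l * (‖x₁ - x₂‖ + ‖y₁ - y₂‖)
  gradY_le : ∀ x₁ x₂ y₁ y₂,
    ‖gradY h x₁ y₁ - gradY h x₂ y₂‖ ≤ l * (‖x₁ - x₂‖ + ‖y₁ - y₂‖)

/-- `(xs, ys)` is a saddle point of `f`. -/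
def IsSaddlePoint {d₁ d₂ : ℕ} (f : E d₁ → E d₂ → ℝ) (xs : E d₁) (ys : E d₂) : Prop :=
  ∀ x y, f xs y ≤ f xs ys ∧ f xs ys ≤ f x ys

/-- A saddle point exists, every `f(·, y)` attains its minimum, every `f(x, ·)` attains its
maximum. -/
structure OptimaExist {d₁ d₂ : ℕ} (f : E d₁ → E d₂ → ℝ) : Prop where
  saddle : ∃ xs ys, IsSaddlePoint f xs ys
  argmin : ∀ y, ∃ xs, ∀ x, f xs y ≤ f x y
  argmax : ∀ x, ∃ ys, ∀ y, f x y ≤ f x ys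

/-- The two-sided Polyak-Łojasiewicz condition with constants `μ₁`, `μ₂`. -/
structure TwoSidedPL {d₁ d₂ : ℕ} (μ₁ μ₂ : ℝ) (f : E d₁ → E d₂ → ℝ) : Prop where
  pl_x : ∀ x y, 2 * μ₁ * (f x y - ⨅ x', f x' y) ≤ ‖gradX f x y‖ ^ 2
  pl_y : ∀ x y, 2 * μ₂ * ((⨆ y', f x y') - f x y) ≤ ‖gradY f x y‖ ^ 2

/-- The average `f = (1/n) ∑ᵢ fᵢ`. -/
def average {n d₁ d₂ : ℕ} (F : Fin n → E d₁ → E d₂ → ℝ) (x : E d₁) (y : E d₂) : ℝ :=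
  (1 / (n : ℝ)) * ∑ i, F i x y

/-- The primal function `g(x) = max_y f(x, y)`. -/
def primal {d₁ d₂ : ℕ} (f : E d₁ → E d₂ → ℝ) (x : E d₁) : ℝ := ⨆ y, f x y

/-- The optimal value `g* = min_x g(x)`. -/
def primalMin {d₁ d₂ : ℕ} (f : E d₁ → E d₂ → ℝ) : ℝ := ⨅ x, primal f x

/-! ### The algorithm, as a randomized program with a counter of component gradients -/

/-- Randomized computations that carry a counter: the number of partial gradients
`∇ₓfᵢ(x, y)` or `∇_y fᵢ(x, y)` of components evaluated so far. -/
abbrev Comp (α : Type) : Type := StateT ℕ PMF α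

/-- Evaluate the component gradient `∇ₓfᵢ(x, y)`, at unit cost. -/
def evalX {n d₁ d₂ : ℕ} (F : Fin n → E d₁ → E d₂ → ℝ) (i : Fin n) (z : E d₁ × E d₂) :
    Comp (E d₁) :=
  fun c => PMF.pure (gradX (F i) z.1 z.2, c + 1)

/-- Evaluate the component gradient `∇_y fᵢ(x, y)`, at unit cost. -/
def evalY {n d₁ d₂ : ℕ} (F : Fin n → E d₁ → E d₂ → ℝ) (i : Fin n) (z : E d₁ × E d₂) :
    Comp (E d₂) :=
  fun c => PMF.pure (gradY (F i) z.1 z.2, c + 1)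

/-- Draw a uniformly distributed index, independent of the past. -/
def uniformIndex (n : ℕ) [NeZero n] : Comp (Fin n) :=
  StateT.lift (PMF.uniformOfFintype (Fin n))

/-- Compute `∇ₓf(x, y) = (1/n) ∑ᵢ ∇ₓfᵢ(x, y)`. -/
def fullX {n d₁ d₂ : ℕ} (F : Fin n → E d₁ → E d₂ → ℝ) (z : E d₁ × E d₂) : Comp (E d₁) := do
  let s ← (List.finRange n).foldlM (fun acc i => do
    let v ← evalX F i z
    pure (acc + v)) 0
  pure ((1 / (n : ℝ)) • s)

/-- Compute `∇_y f(x, y) = (1/n) ∑ᵢ ∇_y fᵢ(x, y)`. -/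
def fullY {n d₁ d₂ : ℕ} (F : Fin n → E d₁ → E d₂ → ℝ) (z : E d₁ × E d₂) : Comp (E d₂) := do
  let s ← (List.finRange n).foldlM (fun acc i => do
    let v ← evalY F i z
    pure (acc + v)) 0
  pure ((1 / (n : ℝ)) • s)

/-- One inner iteration from `z`, with snapshot `w` and full gradients `gx`, `gy` at `w`. -/
def innerStep {n d₁ d₂ : ℕ} [NeZero n] (F : Fin n → E d₁ → E d₂ → ℝ) (τ₁ τ₂ : ℝ)
    (w : E d₁ × E d₂) (gx : E d₁) (gy : E d₂) (z : E d₁ × E d₂) : Comp (E d₁ × E d₂) := do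
  let i₁ ← uniformIndex n
  let i₂ ← uniformIndex n
  let u ← evalX F i₁ z
  let u' ← evalX F i₁ w
  let x := z.1 - τ₁ • (u - u' + gx)
  let v ← evalY F i₂ (x, z.2)
  let v' ← evalY F i₂ w
  let y := z.2 + τ₂ • (v - v' + gy)
  pure (x, y)

/-- Repeat `step` `N` times from `z`. The result is the list `hist` extended by the first `N`
iterates `z = z₀, …, z_{N-1}`, together with the last iterate `z_N`. -/
def innerLoop {α : Type} (step : α → Comp α) : ℕ → List α → α → Comp (List α × α)
  | 0, hist, z => pure (hist, z)
  | N + 1, hist, z => do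
    let z' ← step z
    innerLoop step N (hist ++ [z]) z'

/-- `T` outer iterations with `N` inner iterations each. The result is the list of all
`(x_{t,j}, y_{t,j})` with `0 ≤ t < T`, `0 ≤ j < N`, together with the last iterate. -/
def outerLoop {n d₁ d₂ : ℕ} [NeZero n] (F : Fin n → E d₁ → E d₂ → ℝ) (τ₁ τ₂ : ℝ) (N : ℕ) :
    ℕ → List (E d₁ × E d₂) → E d₁ × E d₂ → Comp (List (E d₁ × E d₂) × (E d₁ × E d₂))
  | 0, hist, w => pure (hist, w)
  | T + 1, hist, w => do
    let gx ← fullX F w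
    let gy ← fullY F w
    let r ← innerLoop (innerStep F τ₁ τ₂ w gx gy) N hist w
    outerLoop F τ₁ τ₂ N T r.1 r.2

/-- Choose an entry of a list uniformly at random (entries counted with repetition); if the list
is empty, return the default `z`. -/
def choose {α : Type} (z : α) : List α → Comp α
  | [] => pure z
  | a :: tl => do
    let i ← uniformIndex (tl.length + 1)
    pure ((a :: tl).get i)

/-- One epoch of VR-AGDA, started at `z`. If there are no inner iterations (`N * T = 0`), the
epoch returns its starting point. -/
def epoch {n d₁ d₂ : ℕ} [NeZero n] (F : Fin n → E d₁ → E d₂ → ℝ) (τ₁ τ₂ : ℝ) (N T : ℕ)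
    (z : E d₁ × E d₂) : Comp (E d₁ × E d₂) := do
  let r ← outerLoop F τ₁ τ₂ N T [] z
  choose z r.1

/-- `k` epochs of VR-AGDA, started at `z`. -/
def epochs {n d₁ d₂ : ℕ} [NeZero n] (F : Fin n → E d₁ → E d₂ → ℝ) (τ₁ τ₂ : ℝ) (N T : ℕ)
    (z : E d₁ × E d₂) : ℕ → Comp (E d₁ × E d₂)
  | 0 => pure z
  | k + 1 => do
    let z' ← epochs F τ₁ τ₂ N T z k
    epoch F τ₁ τ₂ N T z'

/-- The joint law of the point `(x^k, y^k)` after `k` epochs of VR-AGDA started at `z` and of the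
number of component gradients evaluated in these epochs. -/
def law {n d₁ d₂ : ℕ} [NeZero n] (F : Fin n → E d₁ → E d₂ → ℝ) (τ₁ τ₂ : ℝ) (N T : ℕ)
    (z : E d₁ × E d₂) (k : ℕ) : PMF ((E d₁ × E d₂) × ℕ) :=
  (epochs F τ₁ τ₂ N T z k).run 0

/-- Expectation of a real function under a discrete law. (All laws produced by the algorithm have
finite support, so that the sum is finite.) -/
def expect {α : Type} (p : PMF α) (φ : α → ℝ) : ℝ := ∑' a, (p a).toReal * φ a

/-- The potential `P_k = 𝔼[g(x^k) - g*] + (1/20) 𝔼[g(x^k) - f(x^k, y^k)]`. -/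
def potential {n d₁ d₂ : ℕ} [NeZero n] (F : Fin n → E d₁ → E d₂ → ℝ) (τ₁ τ₂ : ℝ) (N T : ℕ)
    (z : E d₁ × E d₂) (k : ℕ) : ℝ :=
  expect (law F τ₁ τ₂ N T z k)
      (fun w => primal (average F) w.1.1 - primalMin (average F)) +
    (1 / 20) * expect (law F τ₁ τ₂ N T z k)
      (fun w => primal (average F) w.1.1 - average F w.1.1 w.1.2)

/-! ### The parameters -/

/-- The stepsize `τ₁ = β / (28 κ⁸ l)`. -/
def stepX (β l κ : ℝ) : ℝ := β / (28 * κ ^ 8 * l)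

/-- The stepsize `τ₂ = β / (l κ⁶)`. -/
def stepY (β l κ : ℝ) : ℝ := β / (l * κ ^ 6)

/-- The number `N = ⌊α β^{-2/3} κ⁹ (2 + 4 β^{1/2} κ⁻³)⁻¹⌋` of inner iterations. -/
def innerCount (α β κ : ℝ) : ℕ :=
  ⌊α * β ^ (-(2 / 3) : ℝ) * κ ^ 9 * (2 + 4 * β ^ (1 / 2 : ℝ) * (κ ^ 3)⁻¹)⁻¹⌋₊

end VRAGDA

end

/-! Write g for `primal (average F)`, μ for the smaller PL constant, and t = β/κ⁶, so that τ₂ = t/l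
and τ₁ = t/(28κ²l). The potential of a point is its `gap`, g - g* + (g - f)/20. One epoch halves its
expectation.

Landscape. PL in y gives quadratic growth (`exists_max_near`): y lies within √(3(g(x) - f(x,y))/μ)
of a maximizer of f(x,·). Hence, when x moves by h, a maximizer has to move only O(κ‖h‖), and g has
a quadratic upper model with curvature O(κl) and slope ∇ₓf at a maximizer (`primal_le_quadratic`).
By weak duality g inherits PL from f (`primal_pl`).

One inner iteration. The estimators are unbiased, with variance at most 2l² times the squared
distance to the snapshot (`mean_estimator_le`). The x-update contracts g - g* by 1 - τ₁μ but costs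
O(τ₁l²/μ)(g - f), because it follows ∇ₓf at y and not at a maximizer. The y-update contracts g - f
at a rate of order μτ₂ = 28κ²τ₁μ, which pays that cost. The variance is paid by the Lyapunov
function `gap` + l t²(N + k)·dist², where dist is the distance to the snapshot and k iterations
remain: its weight drops by l t² per iteration, which covers the noise and the drift
(`mean_lyapunov_le`).

Since dist = 0 at the start, summation bounds τ₁μ times the expected sum of `gap` over the iterates
by the initial `gap`, and the uniform choice divides by Nτ₁μ ≥ 2. This progress needs N of order
κ³/t, while stability needs N²t³, then of order κ⁶t, to be small. Hence t is of order κ⁻⁶ and N of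
order κ⁹. -/

noncomputable section

namespace VRAGDA

/-! ### Expectations under finitely supported laws -/

theorem expect_eq_sum {α : Type} (p : PMF α) (φ : α → ℝ) (s : Finset α)
    (hs : p.support ⊆ s) : expect p φ = ∑ a ∈ s, (p a).toReal * φ a := by
  refine tsum_eq_sum fun a ha => ?_
  have : p a = 0 := by
    by_contra h
    exact ha (hs ((p.mem_support_iff a).2 h))
  simp [this]

theorem expect_pure {α : Type} (a : α) (φ : α → ℝ) : expect (PMF.pure a) φ = φ a := by
  rw [expect_eq_sum _ _ {a} (by simp)]
  simp

theorem support_bind_finite {α β : Type} {p : PMF α} {f : α → PMF β} (hp : p.support.Finite)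
    (hf : ∀ a ∈ p.support, (f a).support.Finite) : (p.bind f).support.Finite := by
  rw [PMF.support_bind]
  exact hp.biUnion hf

/-- The tower property. Finite supports turn every `tsum` into a finite sum, so the order of
summation can be exchanged without any summability condition on `φ`. -/
theorem expect_bind {α β : Type} (p : PMF α) (f : α → PMF β) (φ : β → ℝ)
    (hp : p.support.Finite) (hf : ∀ a ∈ p.support, (f a).support.Finite) :
    expect (p.bind f) φ = expect p fun a => expect (f a) φ := by
  classical
  set T : Finset β := (support_bind_finite hp hf).toFinset with hT
  set S : Finset α := hp.toFinset with hS
  rw [expect_eq_sum _ _ T (by simp [hT]), expect_eq_sum _ _ S (by simp [hS])]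
  have h1 : ∀ b, (p.bind f b).toReal = ∑ a ∈ S, (p a).toReal * (f a b).toReal := by
    intro b
    rw [PMF.bind_apply, tsum_eq_sum (s := S), ENNReal.toReal_sum]
    · simp
    · intro a _
      exact ENNReal.mul_ne_top (p.apply_ne_top a) ((f a).apply_ne_top b)
    · intro a ha
      have : p a = 0 := by
        by_contra h
        exact ha (by simpa [hS] using h)
      simp [this]
  have h2 : ∀ a ∈ S, expect (f a) φ = ∑ b ∈ T, (f a b).toReal * φ b := by
    intro a ha
    refine expect_eq_sum _ _ _ fun b hb => ?_
    have ha' : a ∈ p.support := by simpa [hS] using ha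
    simp only [hT, Set.Finite.coe_toFinset, PMF.mem_support_bind_iff]
    exact ⟨a, ha', hb⟩
  have h3 : ∑ a ∈ S, (p a).toReal * expect (f a) φ =
      ∑ a ∈ S, (p a).toReal * ∑ b ∈ T, (f a b).toReal * φ b :=
    Finset.sum_congr rfl fun a ha => by rw [h2 a ha]
  rw [h3]
  simp only [h1, Finset.mul_sum, Finset.sum_mul]
  rw [Finset.sum_comm]
  simp only [mul_assoc]

theorem expect_le_expect {α : Type} (p : PMF α) (φ ψ : α → ℝ) (hp : p.support.Finite)
    (h : ∀ a ∈ p.support, φ a ≤ ψ a) : expect p φ ≤ expect p ψ := by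
  rw [expect_eq_sum _ _ hp.toFinset (by simp), expect_eq_sum _ _ hp.toFinset (by simp)]
  refine Finset.sum_le_sum fun a ha => ?_
  exact mul_le_mul_of_nonneg_left (h a (by simpa using ha)) ENNReal.toReal_nonneg

theorem expect_congr {α : Type} (p : PMF α) (φ ψ : α → ℝ) (hp : p.support.Finite)
    (h : ∀ a ∈ p.support, φ a = ψ a) : expect p φ = expect p ψ :=
  le_antisymm (expect_le_expect p φ ψ hp fun a ha => (h a ha).le)
    (expect_le_expect p ψ φ hp fun a ha => (h a ha).ge)

theorem expect_add {α : Type} (p : PMF α) (φ ψ : α → ℝ) (hp : p.support.Finite) :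
    expect p (fun a => φ a + ψ a) = expect p φ + expect p ψ := by
  rw [expect_eq_sum _ _ hp.toFinset (by simp), expect_eq_sum _ _ hp.toFinset (by simp),
    expect_eq_sum _ _ hp.toFinset (by simp), ← Finset.sum_add_distrib]
  simp only [mul_add]

theorem expect_const_mul {α : Type} (p : PMF α) (r : ℝ) (φ : α → ℝ) :
    expect p (fun a => r * φ a) = r * expect p φ := by
  unfold expect
  rw [← tsum_mul_left]
  exact tsum_congr fun a => by ring

theorem expect_const {α : Type} (p : PMF α) (r : ℝ) (hp : p.support.Finite) :
    expect p (fun _ => r) = r := by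
  rw [expect_eq_sum _ _ hp.toFinset (by simp), ← Finset.sum_mul]
  have h : ∑ a ∈ hp.toFinset, (p a).toReal = 1 := by
    have h2 : ∑' a, p a = ∑ a ∈ hp.toFinset, p a := tsum_eq_sum fun a ha => by
      by_contra h
      exact ha (by simpa using h)
    rw [← ENNReal.toReal_sum fun a _ => p.apply_ne_top a, ← h2, p.tsum_coe, ENNReal.toReal_one]
  rw [h, one_mul]

/-- The mean of a finite family of real numbers. -/
def mean {n : ℕ} (φ : Fin n → ℝ) : ℝ := (1 / (n : ℝ)) * ∑ i, φ i

theorem expect_uniform {n : ℕ} [NeZero n] (φ : Fin n → ℝ) :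
    expect (PMF.uniformOfFintype (Fin n)) φ = mean φ := by
  rw [expect_eq_sum _ _ Finset.univ (by simp)]
  simp [mean, Finset.mul_sum]

/-! ### Semantics of the program -/

theorem comp_bind_apply {α β : Type} (m : Comp α) (f : α → Comp β) (c : ℕ) :
    (m >>= f) c = (m c).bind fun r => f r.1 r.2 := rfl

theorem comp_pure_apply {α : Type} (a : α) (c : ℕ) : (pure a : Comp α) c = PMF.pure (a, c) := rfl

theorem uniformIndex_apply (n : ℕ) [NeZero n] (c : ℕ) :
    uniformIndex n c = (PMF.uniformOfFintype (Fin n)).bind fun i => PMF.pure (i, c) := rfl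

/-- The accumulation loop shared by `fullX` and `fullY` is deterministic; only the counter has to be
tracked along with the sum. -/
theorem foldlM_apply {ι V : Type} [AddCommMonoid V] (ev : ι → Comp V) (val : ι → V)
    (h : ∀ i c, ev i c = PMF.pure (val i, c + 1)) (L : List ι) (a : V) (c : ℕ) :
    (L.foldlM (fun acc i => do
      let v ← ev i
      pure (acc + v)) a : Comp V) c = PMF.pure (a + (L.map val).sum, c + L.length) := by
  induction L generalizing a c with
  | nil => simp [comp_pure_apply]
  | cons i L ih =>
    rw [List.foldlM_cons, comp_bind_apply, comp_bind_apply, h, PMF.pure_bind, comp_pure_apply,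
      PMF.pure_bind]
    simp only [ih, List.map_cons, List.sum_cons, List.length_cons]
    congr 2
    · rw [add_assoc]
    · ring

theorem fullX_apply {n d₁ d₂ : ℕ} (F : Fin n → E d₁ → E d₂ → ℝ) (z : E d₁ × E d₂) (c : ℕ) :
    fullX F z c = PMF.pure ((1 / (n : ℝ)) • ∑ i, gradX (F i) z.1 z.2, c + n) := by
  rw [fullX, comp_bind_apply,
    foldlM_apply (fun i => evalX F i z) (fun i => gradX (F i) z.1 z.2) (fun i c => rfl), PMF.pure_bind,
    comp_pure_apply, zero_add, List.length_finRange, ← Fin.sum_univ_def]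

theorem fullY_apply {n d₁ d₂ : ℕ} (F : Fin n → E d₁ → E d₂ → ℝ) (z : E d₁ × E d₂) (c : ℕ) :
    fullY F z c = PMF.pure ((1 / (n : ℝ)) • ∑ i, gradY (F i) z.1 z.2, c + n) := by
  rw [fullY, comp_bind_apply,
    foldlM_apply (fun i => evalY F i z) (fun i => gradY (F i) z.1 z.2) (fun i c => rfl), PMF.pure_bind,
    comp_pure_apply, zero_add, List.length_finRange, ← Fin.sum_univ_def]

/-- The updated first block of an inner iteration. -/
def nextX {n d₁ d₂ : ℕ} (F : Fin n → E d₁ → E d₂ → ℝ) (τ₁ : ℝ) (w : E d₁ × E d₂) (gx : E d₁)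
    (z : E d₁ × E d₂) (i : Fin n) : E d₁ :=
  z.1 - τ₁ • (gradX (F i) z.1 z.2 - gradX (F i) w.1 w.2 + gx)

/-- The updated second block of an inner iteration. -/
def nextY {n d₁ d₂ : ℕ} (F : Fin n → E d₁ → E d₂ → ℝ) (τ₂ : ℝ) (w : E d₁ × E d₂) (gy : E d₂)
    (z : E d₁ × E d₂) (i : Fin n) : E d₂ :=
  z.2 + τ₂ • (gradY (F i) z.1 z.2 - gradY (F i) w.1 w.2 + gy)

theorem innerStep_apply {n d₁ d₂ : ℕ} [NeZero n] (F : Fin n → E d₁ → E d₂ → ℝ) (τ₁ τ₂ : ℝ)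
    (w : E d₁ × E d₂) (gx : E d₁) (gy : E d₂) (z : E d₁ × E d₂) (c : ℕ) :
    innerStep F τ₁ τ₂ w gx gy z c =
      (PMF.uniformOfFintype (Fin n)).bind fun i =>
        (PMF.uniformOfFintype (Fin n)).bind fun j =>
          PMF.pure ((nextX F τ₁ w gx z i, nextY F τ₂ w gy (nextX F τ₁ w gx z i, z.2) j), c + 4) := by
  simp only [innerStep, comp_bind_apply, uniformIndex_apply, evalX, evalY, comp_pure_apply,
    PMF.bind_bind, PMF.pure_bind, nextX, nextY, add_assoc]
  rfl

theorem uniform_support_finite (n : ℕ) [NeZero n] :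
    (PMF.uniformOfFintype (Fin n)).support.Finite := Set.toFinite _

theorem expect_uniform_bind {n : ℕ} [NeZero n] {α : Type} (f : Fin n → PMF α) (φ : α → ℝ)
    (hf : ∀ i, (f i).support.Finite) :
    expect ((PMF.uniformOfFintype (Fin n)).bind f) φ = mean fun i => expect (f i) φ := by
  rw [expect_bind _ _ _ (uniform_support_finite n) (fun i _ => hf i), expect_uniform]

theorem innerStep_support_finite {n d₁ d₂ : ℕ} [NeZero n] (F : Fin n → E d₁ → E d₂ → ℝ)
    (τ₁ τ₂ : ℝ) (w : E d₁ × E d₂) (gx : E d₁) (gy : E d₂) (z : E d₁ × E d₂) (c : ℕ) :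
    (innerStep F τ₁ τ₂ w gx gy z c).support.Finite := by
  rw [innerStep_apply]
  exact support_bind_finite (uniform_support_finite n) fun i _ =>
    support_bind_finite (uniform_support_finite n) fun j _ => by simp

theorem innerStep_cost {n d₁ d₂ : ℕ} [NeZero n] (F : Fin n → E d₁ → E d₂ → ℝ)
    (τ₁ τ₂ : ℝ) (w : E d₁ × E d₂) (gx : E d₁) (gy : E d₂) (z : E d₁ × E d₂) (c : ℕ) :
    ∀ r ∈ (innerStep F τ₁ τ₂ w gx gy z c).support, r.2 = c + 4 := by
  intro r hr
  rw [innerStep_apply] at hr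
  simp only [PMF.mem_support_bind_iff, PMF.mem_support_pure_iff] at hr
  obtain ⟨i, -, j, -, rfl⟩ := hr
  rfl

theorem expect_innerStep {n d₁ d₂ : ℕ} [NeZero n] (F : Fin n → E d₁ → E d₂ → ℝ) (τ₁ τ₂ : ℝ)
    (w : E d₁ × E d₂) (gx : E d₁) (gy : E d₂) (z : E d₁ × E d₂) (c : ℕ)
    (φ : E d₁ × E d₂ → ℝ) :
    expect (innerStep F τ₁ τ₂ w gx gy z c) (fun r => φ r.1) =
      mean fun i => mean fun j =>
        φ (nextX F τ₁ w gx z i, nextY F τ₂ w gy (nextX F τ₁ w gx z i, z.2) j) := by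
  rw [innerStep_apply, expect_uniform_bind _ _ fun i =>
    support_bind_finite (uniform_support_finite n) fun j _ => by simp]
  congr 1
  funext i
  rw [expect_uniform_bind _ _ fun j => by simp]
  congr 1
  funext j
  rw [expect_pure]

/-! ### The inner loop: support, cost and Lyapunov summation. -/

section InnerLoop

variable {α : Type} {step : α → Comp α}

theorem innerLoop_succ_apply (N : ℕ) (hist : List α) (z : α) (c : ℕ) :
    innerLoop step (N + 1) hist z c =
      (step z c).bind fun r => innerLoop step N (hist ++ [z]) r.1 r.2 := rfl

theorem innerLoop_support_finite (hfin : ∀ z c, (step z c).support.Finite) (N : ℕ)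
    (hist : List α) (z : α) (c : ℕ) : (innerLoop step N hist z c).support.Finite := by
  induction N generalizing hist z c with
  | zero => simp [innerLoop, comp_pure_apply]
  | succ N ih =>
    rw [innerLoop_succ_apply]
    exact support_bind_finite (hfin z c) fun r _ => ih _ _ _

theorem innerLoop_length_cost {q : ℕ} (hcost : ∀ z c, ∀ r ∈ (step z c).support, r.2 = c + q)
    (N : ℕ) (hist : List α) (z : α) (c : ℕ) :
    ∀ r ∈ (innerLoop step N hist z c).support,
      r.1.1.length = hist.length + N ∧ r.2 = c + q * N := by
  induction N generalizing hist z c with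
  | zero => simp [innerLoop, comp_pure_apply]
  | succ N ih =>
    intro r hr
    rw [innerLoop_succ_apply, PMF.mem_support_bind_iff] at hr
    obtain ⟨s, hs, hr⟩ := hr
    have h1 := ih _ _ _ r hr
    have h2 := hcost z c s hs
    constructor
    · rw [h1.1]; simp; ring
    · rw [h1.2, h2]; ring

/-- If `V` decreases in expectation by at least `φ` along each step, then the expected sum of `φ`
over the iterates is at most the initial value of `V`. -/
theorem expect_innerLoop_le (hfin : ∀ z c, (step z c).support.Finite) (φ : α → ℝ)
    (V : ℕ → α → ℝ) (h0 : ∀ z, 0 ≤ V 0 z) (N : ℕ)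
    (hV : ∀ k < N, ∀ z c, φ z + expect (step z c) (fun r => V k r.1) ≤ V (k + 1) z)
    (hist : List α) (z : α) (c : ℕ) :
    expect (innerLoop step N hist z c) (fun r => (r.1.1.map φ).sum) ≤
      (hist.map φ).sum + V N z := by
  induction N generalizing hist z c with
  | zero =>
    rw [innerLoop, comp_pure_apply, expect_pure]
    have := h0 z
    linarith
  | succ N ih =>
    rw [innerLoop_succ_apply, expect_bind _ _ _ (hfin z c) fun r _ =>
      innerLoop_support_finite hfin _ _ _ _]
    -- The index of `V` counts the iterations still to be made, so the induction hypothesis applies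
    -- after the first step.
    calc _ ≤ expect (step z c) (fun r => ((hist ++ [z]).map φ).sum + V N r.1) :=
          expect_le_expect _ _ _ (hfin z c) fun r _ =>
            ih (fun k hk => hV k (by omega)) _ _ _
      _ = ((hist ++ [z]).map φ).sum + expect (step z c) (fun r => V N r.1) := by
          rw [expect_add _ _ _ (hfin z c), expect_const _ _ (hfin z c)]
      _ ≤ _ := by
          have := hV N (by omega) z c
          simp only [List.map_append, List.sum_append, List.map_cons, List.map_nil,
            List.sum_cons, List.sum_nil]
          linarith

end InnerLoop

/-! ### The random choice of an iterate, and whole epochs. -/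

theorem choose_support_finite {α : Type} (z : α) (L : List α) (c : ℕ) :
    (choose z L c).support.Finite := by
  cases L with
  | nil => simp [choose, comp_pure_apply]
  | cons a tl =>
    rw [choose, comp_bind_apply, uniformIndex_apply]
    exact support_bind_finite (support_bind_finite (uniform_support_finite _) (by simp))
      (by simp [comp_pure_apply])

theorem choose_cost {α : Type} (z : α) (L : List α) (c : ℕ) :
    ∀ r ∈ (choose z L c).support, r.2 = c := by
  cases L with
  | nil => simp [choose, comp_pure_apply]
  | cons a tl =>
    intro r hr
    rw [choose, comp_bind_apply, uniformIndex_apply, PMF.bind_bind] at hr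
    simp only [PMF.pure_bind, comp_pure_apply, PMF.mem_support_bind_iff,
      PMF.mem_support_pure_iff] at hr
    obtain ⟨i, -, rfl⟩ := hr
    rfl

theorem expect_choose {α : Type} (z : α) (L : List α) (c : ℕ) (hL : L ≠ []) (φ : α → ℝ) :
    expect (choose z L c) (fun r => φ r.1) = (1 / (L.length : ℝ)) * (L.map φ).sum := by
  cases L with
  | nil => exact absurd rfl hL
  | cons a tl =>
    rw [choose, comp_bind_apply, uniformIndex_apply, PMF.bind_bind]
    simp only [PMF.pure_bind, comp_pure_apply]
    rw [expect_uniform_bind _ _ fun i => by simp]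
    simp only [expect_pure, mean]
    congr 1
    have := Fin.sum_univ_fun_getElem (a :: tl) φ
    rw [← this]
    rfl

theorem epoch_apply {n d₁ d₂ : ℕ} [NeZero n] (F : Fin n → E d₁ → E d₂ → ℝ) (τ₁ τ₂ : ℝ) (N : ℕ)
    (w : E d₁ × E d₂) (c : ℕ) :
    epoch F τ₁ τ₂ N 1 w c =
      (innerLoop (innerStep F τ₁ τ₂ w ((1 / (n : ℝ)) • ∑ i, gradX (F i) w.1 w.2)
        ((1 / (n : ℝ)) • ∑ i, gradY (F i) w.1 w.2)) N [] w (c + n + n)).bind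
        fun r => choose w r.1.1 r.2 := by
  simp only [epoch, outerLoop, comp_bind_apply, fullX_apply, fullY_apply, PMF.pure_bind,
    PMF.bind_bind, comp_pure_apply]

theorem epoch_support_finite {n d₁ d₂ : ℕ} [NeZero n] (F : Fin n → E d₁ → E d₂ → ℝ)
    (τ₁ τ₂ : ℝ) (N : ℕ) (w : E d₁ × E d₂) (c : ℕ) :
    (epoch F τ₁ τ₂ N 1 w c).support.Finite := by
  rw [epoch_apply]
  exact support_bind_finite (innerLoop_support_finite
    (fun _ _ => innerStep_support_finite _ _ _ _ _ _ _ _) _ _ _ _)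
    fun r _ => choose_support_finite _ _ _

theorem epoch_cost {n d₁ d₂ : ℕ} [NeZero n] (F : Fin n → E d₁ → E d₂ → ℝ)
    (τ₁ τ₂ : ℝ) (N : ℕ) (w : E d₁ × E d₂) (c : ℕ) :
    ∀ r ∈ (epoch F τ₁ τ₂ N 1 w c).support, r.2 = c + (2 * n + 4 * N) := by
  intro r hr
  rw [epoch_apply, PMF.mem_support_bind_iff] at hr
  obtain ⟨s, hs, hr⟩ := hr
  rw [choose_cost _ _ _ r hr, (innerLoop_length_cost
    (fun _ _ => innerStep_cost _ _ _ _ _ _ _ _) _ _ _ _ s hs).2]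
  ring

/-- A Lyapunov function for the inner iterations bounds the expectation of `φ` at the outcome of
an epoch. -/
theorem expect_epoch_le {n d₁ d₂ : ℕ} [NeZero n] (F : Fin n → E d₁ → E d₂ → ℝ) (τ₁ τ₂ : ℝ)
    (N : ℕ) (hN : 1 ≤ N) (w : E d₁ × E d₂) (c : ℕ) (φ : E d₁ × E d₂ → ℝ)
    (V : ℕ → E d₁ × E d₂ → ℝ) (h0 : ∀ z, 0 ≤ V 0 z)
    (hV : ∀ k < N, ∀ z : E d₁ × E d₂, φ z + (mean fun i => mean fun j =>
      V k (nextX F τ₁ w ((1 / (n : ℝ)) • ∑ i, gradX (F i) w.1 w.2) z i,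
        nextY F τ₂ w ((1 / (n : ℝ)) • ∑ i, gradY (F i) w.1 w.2)
          (nextX F τ₁ w ((1 / (n : ℝ)) • ∑ i, gradX (F i) w.1 w.2) z i, z.2) j)) ≤ V (k + 1) z) :
    expect (epoch F τ₁ τ₂ N 1 w c) (fun r => φ r.1) ≤ (1 / (N : ℝ)) * V N w := by
  have hfin := innerStep_support_finite F τ₁ τ₂ w ((1 / (n : ℝ)) • ∑ i, gradX (F i) w.1 w.2)
    ((1 / (n : ℝ)) • ∑ i, gradY (F i) w.1 w.2)
  have hloop := innerLoop_support_finite hfin N [] w (c + n + n)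
  rw [epoch_apply, expect_bind _ _ _ hloop fun r _ => choose_support_finite _ _ _]
  rw [expect_congr _ _ (fun r => (1 / (N : ℝ)) * (r.1.1.map φ).sum) hloop, expect_const_mul]
  · refine mul_le_mul_of_nonneg_left ?_ (by positivity)
    refine (expect_innerLoop_le hfin φ V h0 N ?_ _ _ _).trans (by simp)
    intro k hk z c
    rw [expect_innerStep]
    exact hV k hk z
  · intro r hr
    have hlen := (innerLoop_length_cost (innerStep_cost F τ₁ τ₂ w _ _) N [] w _ r hr).1
    simp only [List.length_nil, zero_add] at hlen
    rw [expect_choose, hlen]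
    intro h
    rw [h] at hlen
    simp only [List.length_nil] at hlen
    omega

/-! ### The law after several epochs, its cost and its potential. -/

theorem law_zero {n d₁ d₂ : ℕ} [NeZero n] (F : Fin n → E d₁ → E d₂ → ℝ) (τ₁ τ₂ : ℝ) (N : ℕ)
    (z : E d₁ × E d₂) : law F τ₁ τ₂ N 1 z 0 = PMF.pure (z, 0) := rfl

theorem law_succ {n d₁ d₂ : ℕ} [NeZero n] (F : Fin n → E d₁ → E d₂ → ℝ) (τ₁ τ₂ : ℝ) (N : ℕ)
    (z : E d₁ × E d₂) (k : ℕ) :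
    law F τ₁ τ₂ N 1 z (k + 1) =
      (law F τ₁ τ₂ N 1 z k).bind fun r => epoch F τ₁ τ₂ N 1 r.1 r.2 := rfl

theorem law_support_finite {n d₁ d₂ : ℕ} [NeZero n] (F : Fin n → E d₁ → E d₂ → ℝ) (τ₁ τ₂ : ℝ)
    (N : ℕ) (z : E d₁ × E d₂) (k : ℕ) : (law F τ₁ τ₂ N 1 z k).support.Finite := by
  induction k with
  | zero => simp [law_zero]
  | succ k ih =>
    rw [law_succ]
    exact support_bind_finite ih fun r _ => epoch_support_finite _ _ _ _ _ _

theorem law_cost {n d₁ d₂ : ℕ} [NeZero n] (F : Fin n → E d₁ → E d₂ → ℝ) (τ₁ τ₂ : ℝ)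
    (N : ℕ) (z : E d₁ × E d₂) (k : ℕ) :
    ∀ r ∈ (law F τ₁ τ₂ N 1 z k).support, r.2 = k * (2 * n + 4 * N) := by
  induction k with
  | zero => simp [law_zero]
  | succ k ih =>
    intro r hr
    rw [law_succ, PMF.mem_support_bind_iff] at hr
    obtain ⟨s, hs, hr⟩ := hr
    rw [epoch_cost _ _ _ _ _ _ r hr, ih s hs]
    ring

/-- The value of the potential at a point. -/
def gap {d₁ d₂ : ℕ} (f : E d₁ → E d₂ → ℝ) (z : E d₁ × E d₂) : ℝ :=
  (primal f z.1 - primalMin f) + (1 / 20) * (primal f z.1 - f z.1 z.2)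

theorem potential_eq {n d₁ d₂ : ℕ} [NeZero n] (F : Fin n → E d₁ → E d₂ → ℝ) (τ₁ τ₂ : ℝ)
    (N : ℕ) (z : E d₁ × E d₂) (k : ℕ) :
    potential F τ₁ τ₂ N 1 z k =
      expect (law F τ₁ τ₂ N 1 z k) (fun r => gap (average F) r.1) := by
  unfold potential gap
  rw [expect_add _ _ _ (law_support_finite _ _ _ _ _ _), expect_const_mul]

/-- A contraction from every deterministic start passes to random starts by conditioning on the
outcome of the earlier epochs. -/
theorem potential_succ_le {n d₁ d₂ : ℕ} [NeZero n] (F : Fin n → E d₁ → E d₂ → ℝ) (τ₁ τ₂ : ℝ)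
    (N : ℕ) (z : E d₁ × E d₂) (r : ℝ)
    (h : ∀ w c, expect (epoch F τ₁ τ₂ N 1 w c) (fun s => gap (average F) s.1) ≤
      r * gap (average F) w) (k : ℕ) :
    potential F τ₁ τ₂ N 1 z (k + 1) ≤ r * potential F τ₁ τ₂ N 1 z k := by
  have hfin := law_support_finite F τ₁ τ₂ N z k
  rw [potential_eq, potential_eq, law_succ, expect_bind _ _ _ hfin
    fun r _ => epoch_support_finite _ _ _ _ _ _, ← expect_const_mul]
  exact expect_le_expect _ _ _ hfin fun s _ => h _ _

/-! ### Functions with Lipschitz gradient -/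

section Gradient

variable {V : Type*} [NormedAddCommGroup V] [InnerProductSpace ℝ V] [CompleteSpace V]
  {φ : V → ℝ} {G : V → V} {l : ℝ}

/-- Along the segment, the difference between `φ` and its quadratic model has derivative at most 0,
by Cauchy-Schwarz and the Lipschitz bound. -/
theorem le_quadratic (hφ : ∀ x, HasGradientAt φ (G x) x)
    (hG : ∀ x y, ‖G x - G y‖ ≤ l * ‖x - y‖) (x h : V) :
    φ (x + h) ≤ φ x + inner ℝ (G x) h + l / 2 * ‖h‖ ^ 2 := by
  set ψ : ℝ → ℝ := fun t => φ (x + t • h) - t * inner ℝ (G x) h - l / 2 * t ^ 2 * ‖h‖ ^ 2 with hψ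
  have hd : ∀ t, HasDerivAt ψ (inner ℝ (G (x + t • h)) h - inner ℝ (G x) h
      - l * t * ‖h‖ ^ 2) t := by
    intro t
    have h1 : HasDerivAt (fun t : ℝ => x + t • h) h t := by
      simpa using ((hasDerivAt_id t).smul_const h).const_add x
    have h2 : HasDerivAt (fun t : ℝ => φ (x + t • h)) (inner ℝ (G (x + t • h)) h) t := by
      have := (hφ (x + t • h)).hasFDerivAt.comp_hasDerivAt t h1
      simpa [Function.comp_def] using this
    have h3 := (hasDerivAt_id t).mul_const (inner ℝ (G x) h)
    have h4 := (((hasDerivAt_id t).pow 2).const_mul (l / 2)).mul_const (‖h‖ ^ 2)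
    refine ((h2.sub h3).sub h4).congr_deriv ?_
    simp only [id, Nat.cast_ofNat, Nat.add_one_sub_one, pow_one]
    ring
  have hanti : AntitoneOn ψ (Set.Icc 0 1) := by
    refine antitoneOn_of_deriv_nonpos (convex_Icc 0 1)
      (fun t _ => (hd t).continuousAt.continuousWithinAt)
      (fun t _ => (hd t).differentiableAt.differentiableWithinAt) ?_
    intro t ht
    rw [interior_Icc] at ht
    rw [(hd t).deriv, ← inner_sub_left]
    have h1 := real_inner_le_norm (G (x + t • h) - G x) h
    have h2 := hG (x + t • h) x
    rw [add_sub_cancel_left, norm_smul, Real.norm_of_nonneg ht.1.le] at h2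
    nlinarith [norm_nonneg h, mul_le_mul_of_nonneg_right h2 (norm_nonneg h)]
  have := hanti (Set.left_mem_Icc.2 zero_le_one) (Set.right_mem_Icc.2 zero_le_one) zero_le_one
  simp only [hψ, one_smul, zero_smul, add_zero] at this
  linarith

theorem quadratic_le (hφ : ∀ x, HasGradientAt φ (G x) x)
    (hG : ∀ x y, ‖G x - G y‖ ≤ l * ‖x - y‖) (x h : V) :
    φ x + inner ℝ (G x) h - l / 2 * ‖h‖ ^ 2 ≤ φ (x + h) := by
  have h1 : ∀ x, HasGradientAt (fun x => -φ x) (-G x) x := by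
    intro x
    rw [hasGradientAt_iff_hasFDerivAt, map_neg]
    exact (hφ x).hasFDerivAt.neg
  have := le_quadratic (l := l) h1 (fun x y => by
    rw [← neg_sub', norm_neg]; exact hG x y) x h
  rw [inner_neg_left] at this
  linarith

/-- The squared gradient is controlled by the distance to an upper bound of the function. -/
theorem norm_sq_le_of_le (hl : 0 < l) (hφ : ∀ x, HasGradientAt φ (G x) x)
    (hG : ∀ x y, ‖G x - G y‖ ≤ l * ‖x - y‖) {M : ℝ} (hM : ∀ z, φ z ≤ M) (x : V) :
    ‖G x‖ ^ 2 ≤ 2 * l * (M - φ x) := by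
  -- The step 1/l along the gradient maximizes the quadratic lower model.
  have h1 := quadratic_le hφ hG x ((1 / l) • G x)
  have h2 := hM (x + (1 / l) • G x)
  rw [inner_smul_right, real_inner_self_eq_norm_sq, norm_smul, mul_pow, Real.norm_of_nonneg
    (by positivity)] at h1
  have h3 : l / 2 * ((1 / l) ^ 2 * ‖G x‖ ^ 2) = 1 / l * ‖G x‖ ^ 2 / 2 := by
    field_simp
  have h4 : 1 / l * ‖G x‖ ^ 2 ≤ 2 * (M - φ x) := by linarith
  calc ‖G x‖ ^ 2 = l * (1 / l * ‖G x‖ ^ 2) := by field_simp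
    _ ≤ l * (2 * (M - φ x)) := by gcongr
    _ = _ := by ring

/-- The Polyak-Łojasiewicz inequality implies quadratic growth. -/
theorem exists_max_near [FiniteDimensional ℝ V] (hl : 0 < l) (hφ : ∀ x, HasGradientAt φ (G x) x)
    (hG : ∀ x y, ‖G x - G y‖ ≤ l * ‖x - y‖) {M μ : ℝ} (hμ : 0 < μ) (hM : ∀ z, φ z ≤ M)
    (hPL : ∀ z, 2 * μ * (M - φ z) ≤ ‖G z‖ ^ 2) (y : V) :
    ∃ ys, φ ys = M ∧ ‖y - ys‖ ^ 2 ≤ 3 / μ * (M - φ y) := by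
  -- Minimize D + s‖· - y‖ with D = √(M - φ), which replaces following the gradient flow. Where D >
  -- 0, PL makes the slope of D at least √(μ/2). As s = √(μ/3) is strictly smaller, a short gradient
  -- step would lower the penalized function, so D = 0 at the minimizer. The slack between the two
  -- constants allows an explicit step.
  set s : ℝ := Real.sqrt (μ / 3) with hs
  have hs0 : 0 < s := Real.sqrt_pos.2 (by positivity)
  have hs2 : s ^ 2 = μ / 3 := Real.sq_sqrt (by positivity)
  set D : V → ℝ := fun z => Real.sqrt (M - φ z) with hD
  have hD0 : ∀ z, 0 ≤ D z := fun z => Real.sqrt_nonneg _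
  have hD2 : ∀ z, D z ^ 2 = M - φ z := fun z => Real.sq_sqrt (by linarith [hM z])
  have hcont : Continuous fun z => D z + s * ‖z - y‖ := by
    have : Continuous φ := continuous_iff_continuousAt.2 fun z => (hφ z).differentiableAt.continuousAt
    fun_prop
  obtain ⟨z, -, hz⟩ := (isCompact_closedBall y (D y / s)).exists_isMinOn
    ⟨y, Metric.mem_closedBall_self (div_nonneg (hD0 y) hs0.le)⟩ hcont.continuousOn
  have hmin : ∀ x, D z + s * ‖z - y‖ ≤ D x + s * ‖x - y‖ := by
    intro x
    by_cases hx : x ∈ Metric.closedBall y (D y / s)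
    · exact hz hx
    · have h1 : D z + s * ‖z - y‖ ≤ D y + s * ‖y - y‖ :=
        hz (Metric.mem_closedBall_self (div_nonneg (hD0 y) hs0.le))
      rw [Metric.mem_closedBall, not_le, dist_eq_norm, div_lt_iff₀ hs0] at hx
      rw [sub_self, norm_zero] at h1
      linarith [hD0 x]
  have hzD : D z = 0 := by
    by_contra hne
    have hpos : 0 < D z := lt_of_le_of_ne (hD0 z) (Ne.symm hne)
    set d := ‖G z‖ with hd
    have hPLz : 2 * μ * D z ^ 2 ≤ d ^ 2 := by rw [hD2]; exact hPL z
    have hdpos : 0 < d := by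
      rcases (norm_nonneg (G z)).lt_or_eq with h | h
      · exact h
      · rw [← hd] at h
        rw [← h] at hPLz
        have : 0 < 2 * μ * D z ^ 2 := by positivity
        linarith
    -- The first bound makes the curvature loss at most a tenth of the first-order gain; the second
    -- keeps D z - s t d nonnegative, so that it may be squared.
    set t : ℝ := min (1 / (5 * l)) (D z / (s * d)) with ht
    have ht0 : 0 < t := lt_min (by positivity) (by positivity)
    have ht1 : l * t ≤ 1 / 5 := by
      have : t ≤ 1 / (5 * l) := min_le_left _ _
      calc l * t ≤ l * (1 / (5 * l)) := by gcongr
        _ = 1 / 5 := by field_simp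
    have ht2 : s * (t * d) ≤ D z := by
      have : t ≤ D z / (s * d) := min_le_right _ _
      rw [le_div_iff₀ (by positivity)] at this
      linarith
    have h1 := hmin (z + t • G z)
    have h2 : ‖z + t • G z - y‖ ≤ ‖z - y‖ + t * d := by
      have : z + t • G z - y = (z - y) + t • G z := by abel
      rw [this]
      refine (norm_add_le _ _).trans ?_
      rw [norm_smul, Real.norm_of_nonneg ht0.le]
    have h3 : D z - s * (t * d) ≤ D (z + t • G z) := by
      nlinarith [mul_le_mul_of_nonneg_left h2 hs0.le]
    have h4 : (D z - s * (t * d)) ^ 2 ≤ M - φ (z + t • G z) := by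
      rw [← hD2]
      exact pow_le_pow_left₀ (by linarith) h3 2
    have h5 := quadratic_le hφ hG z (t • G z)
    rw [inner_smul_right, real_inner_self_eq_norm_sq, norm_smul, Real.norm_of_nonneg ht0.le,
      mul_pow, ← hd] at h5
    have h6 := hD2 z
    have h7 : t * d * (d * (1 - l * t / 2)) ≤ t * d * (2 * s * D z) := by
      nlinarith [sq_nonneg (s * (t * d))]
    have h8 := le_of_mul_le_mul_left h7 (by positivity)
    have h9 : d * (9 / 10) ≤ 2 * s * D z := by nlinarith
    have h10 : (d * (9 / 10)) ^ 2 ≤ (2 * s * D z) ^ 2 := pow_le_pow_left₀ (by positivity) h9 2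
    have h11 : (2 * s * D z) ^ 2 = 4 * (μ / 3) * D z ^ 2 := by rw [← hs2]; ring
    have h12 : 0 < μ * D z ^ 2 := by positivity
    -- The contradiction is 0.81 · 2μ D² ≤ (4/3) μ D² with D > 0.
    nlinarith
  refine ⟨z, ?_, ?_⟩
  · have := hD2 z
    rw [hzD] at this
    linarith
  · have h1 := hmin y
    rw [hzD, sub_self, norm_zero, mul_zero, zero_add, add_zero, norm_sub_rev] at h1
    have h2 := pow_le_pow_left₀ (by positivity) h1 2
    rw [mul_pow, hs2, hD2] at h2
    calc ‖y - z‖ ^ 2 = 3 / μ * (μ / 3 * ‖y - z‖ ^ 2) := by field_simp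
      _ ≤ _ := by gcongr

end Gradient

/-! ### The minimax objective -/

section Objective

variable {d₁ d₂ : ℕ} {f : E d₁ → E d₂ → ℝ} {l μ : ℝ}

theorem LipschitzGradient.hasGradientAt_x (hf : LipschitzGradient l f) (x : E d₁) (y : E d₂) :
    HasGradientAt (fun x' => f x' y) (gradX f x y) x := by
  refine DifferentiableAt.hasGradientAt ?_
  have h1 : DifferentiableAt ℝ (fun z : E d₁ × E d₂ => f z.1 z.2) (x, y) :=
    (hf.contDiff.differentiable (by simp)) _
  exact DifferentiableAt.comp (f := fun x' : E d₁ => (x', y)) x h1 (by fun_prop)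

theorem LipschitzGradient.hasGradientAt_y (hf : LipschitzGradient l f) (x : E d₁) (y : E d₂) :
    HasGradientAt (fun y' => f x y') (gradY f x y) y := by
  refine DifferentiableAt.hasGradientAt ?_
  have h1 : DifferentiableAt ℝ (fun z : E d₁ × E d₂ => f z.1 z.2) (x, y) :=
    (hf.contDiff.differentiable (by simp)) _
  exact DifferentiableAt.comp (f := fun y' : E d₂ => (x, y')) y h1 (by fun_prop)

theorem LipschitzGradient.lipschitz_x (hf : LipschitzGradient l f) (y : E d₂) (x x' : E d₁) :
    ‖gradX f x y - gradX f x' y‖ ≤ l * ‖x - x'‖ := by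
  simpa using hf.gradX_le x x' y y

theorem LipschitzGradient.lipschitz_y (hf : LipschitzGradient l f) (x : E d₁) (y y' : E d₂) :
    ‖gradY f x y - gradY f x y'‖ ≤ l * ‖y - y'‖ := by
  simpa using hf.gradY_le x x y y'

/-! ### Gradients of the average. -/

section Average

variable {n : ℕ} {F : Fin n → E d₁ → E d₂ → ℝ}

theorem hasGradientAt_average {V : Type*} [NormedAddCommGroup V] [InnerProductSpace ℝ V]
    [CompleteSpace V] {φ : Fin n → V → ℝ} {G : Fin n → V} {x : V}
    (h : ∀ i, HasGradientAt (φ i) (G i) x) :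
    HasGradientAt (fun x => (1 / (n : ℝ)) * ∑ i, φ i x) ((1 / (n : ℝ)) • ∑ i, G i) x := by
  rw [hasGradientAt_iff_hasFDerivAt]
  have h1 : HasFDerivAt (fun x => ∑ i, φ i x) (∑ i, InnerProductSpace.toDual ℝ V (G i)) x := by
    exact HasFDerivAt.fun_sum fun i _ => (h i).hasFDerivAt
  have := h1.const_mul (1 / (n : ℝ))
  simpa using this

theorem gradX_average (hF : ∀ i, LipschitzGradient l (F i)) (x : E d₁) (y : E d₂) :
    gradX (average F) x y = (1 / (n : ℝ)) • ∑ i, gradX (F i) x y :=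
  (hasGradientAt_average fun i => (hF i).hasGradientAt_x x y).gradient

theorem gradY_average (hF : ∀ i, LipschitzGradient l (F i)) (x : E d₁) (y : E d₂) :
    gradY (average F) x y = (1 / (n : ℝ)) • ∑ i, gradY (F i) x y :=
  (hasGradientAt_average fun i => (hF i).hasGradientAt_y x y).gradient

theorem norm_average_sub_le [NeZero n] {V : Type*} [NormedAddCommGroup V] [NormedSpace ℝ V]
    {u v : Fin n → V} {r : ℝ} (h : ∀ i, ‖u i - v i‖ ≤ r) :
    ‖(1 / (n : ℝ)) • ∑ i, u i - (1 / (n : ℝ)) • ∑ i, v i‖ ≤ r := by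
  have hn : (0 : ℝ) < n := Nat.cast_pos.2 (NeZero.pos n)
  rw [← smul_sub, ← Finset.sum_sub_distrib, norm_smul, Real.norm_of_nonneg (by positivity)]
  have : ‖∑ i, (u i - v i)‖ ≤ n * r := by
    refine (norm_sum_le_of_le _ fun i _ => h i).trans ?_
    simp
  calc 1 / (n : ℝ) * ‖∑ i, (u i - v i)‖ ≤ 1 / (n : ℝ) * (n * r) := by gcongr
    _ = r := by field_simp

theorem LipschitzGradient.average [NeZero n] (hF : ∀ i, LipschitzGradient l (F i)) :
    LipschitzGradient l (average F) where
  contDiff := by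
    unfold VRAGDA.average
    exact contDiff_const.mul (ContDiff.sum fun i _ => (hF i).contDiff)
  gradX_le x₁ x₂ y₁ y₂ := by
    rw [gradX_average hF, gradX_average hF]
    exact norm_average_sub_le fun i => (hF i).gradX_le _ _ _ _
  gradY_le x₁ x₂ y₁ y₂ := by
    rw [gradY_average hF, gradY_average hF]
    exact norm_average_sub_le fun i => (hF i).gradY_le _ _ _ _

end Average

/-! ### Optimal values, the condition number and the primal function. -/

theorem OptimaExist.le_primal (ho : OptimaExist f) (x : E d₁) (y : E d₂) : f x y ≤ primal f x := by
  obtain ⟨ys, hys⟩ := ho.argmax x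
  exact le_ciSup ⟨f x ys, by rintro _ ⟨y', rfl⟩; exact hys y'⟩ y

theorem OptimaExist.iInf_le (ho : OptimaExist f) (x : E d₁) (y : E d₂) :
    ⨅ x', f x' y ≤ f x y := by
  obtain ⟨xs, hxs⟩ := ho.argmin y
  exact ciInf_le ⟨f xs y, by rintro _ ⟨x', rfl⟩; exact hxs x'⟩ x

/-- The saddle value bounds g from below, as the conditionally complete infimum requires. -/
theorem OptimaExist.primalMin_le (ho : OptimaExist f) (x : E d₁) : primalMin f ≤ primal f x := by
  obtain ⟨xs, ys, h⟩ := ho.saddle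
  refine ciInf_le ⟨f xs ys, ?_⟩ x
  rintro _ ⟨x', rfl⟩
  exact (h x' ys).2.trans (ho.le_primal x' ys)

/-- Weak duality; it lets g inherit the PL inequality in x. -/
theorem OptimaExist.iInf_le_primalMin (ho : OptimaExist f) (y : E d₂) :
    ⨅ x', f x' y ≤ primalMin f :=
  le_ciInf fun x => (ho.iInf_le x y).trans (ho.le_primal x y)

theorem OptimaExist.gap_nonneg (ho : OptimaExist f) (z : E d₁ × E d₂) : 0 ≤ gap f z := by
  have h1 := ho.primalMin_le z.1
  have h2 := ho.le_primal z.1 z.2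
  unfold gap
  linarith

theorem TwoSidedPL.mono {μ₁ μ₂ : ℝ} (ho : OptimaExist f) (h : TwoSidedPL μ₁ μ₂ f) (h₁ : μ ≤ μ₁)
    (h₂ : μ ≤ μ₂) : TwoSidedPL μ μ f where
  pl_x x y := by
    refine le_trans ?_ (h.pl_x x y)
    have := ho.iInf_le x y
    exact mul_le_mul_of_nonneg_right (by linarith) (by linarith)
  pl_y x y := by
    refine le_trans ?_ (h.pl_y x y)
    have := ho.le_primal x y
    exact mul_le_mul_of_nonneg_right (by linarith) (by unfold primal at this; linarith)

/-- Unless the objective is constant, its condition number is at least `1`. -/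
theorem TwoSidedPL.le_of_ne (hl : 0 < l) (hf : LipschitzGradient l f) (ho : OptimaExist f)
    (hp : TwoSidedPL μ μ f) (hne : ∃ x y x' y', f x y ≠ f x' y') : μ ≤ l := by
  by_contra! hlt
  -- PL bounds the squared gradient below by 2μ times the optimality gap, smoothness above by 2l
  -- times it. If l < μ both gaps vanish, so f depends on neither variable.
  have hx : ∀ x y, f x y = ⨅ x', f x' y := by
    intro x y
    have h0 := ho.iInf_le x y
    have h1 := hp.pl_x x y
    have hneg : ∀ x, HasGradientAt (fun x => -f x y) (-gradX f x y) x := by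
      intro x
      rw [hasGradientAt_iff_hasFDerivAt, map_neg]
      exact (hf.hasGradientAt_x x y).hasFDerivAt.neg
    have h2 := norm_sq_le_of_le (M := -⨅ x', f x' y) hl hneg (fun x x' => by
      rw [← neg_sub', norm_neg]; exact hf.lipschitz_x y x x')
      (fun x => neg_le_neg (ho.iInf_le x y)) x
    rw [norm_neg] at h2
    nlinarith
  have hy : ∀ x y, f x y = primal f x := by
    intro x y
    have h0 := ho.le_primal x y
    have h1 : 2 * μ * (primal f x - f x y) ≤ _ := hp.pl_y x y
    have h2 := norm_sq_le_of_le hl (hf.hasGradientAt_y x) (hf.lipschitz_y x) (ho.le_primal x) y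
    nlinarith
  obtain ⟨x, y, x', y', h⟩ := hne
  exact h (by rw [hx x y, ← hx x' y, hy, hy])

theorem exists_argmax_near (hl : 0 < l) (hμ : 0 < μ) (hf : LipschitzGradient l f)
    (ho : OptimaExist f) (hp : TwoSidedPL μ μ f) (x : E d₁) (y : E d₂) :
    ∃ ys, f x ys = primal f x ∧ ‖y - ys‖ ^ 2 ≤ 3 / μ * (primal f x - f x y) :=
  exists_max_near hl (hf.hasGradientAt_y x) (hf.lipschitz_y x) hμ (ho.le_primal x)
    (hp.pl_y x) y

theorem gradY_eq_zero (ho : OptimaExist f) {x : E d₁} {y : E d₂}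
    (h : f x y = primal f x) : gradY f x y = 0 := by
  have : IsLocalMax (fun y' => f x y') y := Filter.Eventually.of_forall fun y' => by
    simpa [h] using ho.le_primal x y'
  simp [gradY, gradient, this.fderiv_eq_zero]

/-- The primal function is smooth, with gradient `∇ₓf(x, y)` for any maximizer `y`. -/
theorem primal_le_quadratic (hμ : 0 < μ) (hμl : μ ≤ l) (hf : LipschitzGradient l f)
    (ho : OptimaExist f) (hp : TwoSidedPL μ μ f) {x : E d₁} {y : E d₂} (hy : f x y = primal f x)
    (h : E d₁) :
    primal f (x + h) ≤ primal f x + inner ℝ (gradX f x y) h + 2 * l * (l / μ) * ‖h‖ ^ 2 := by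
  have hl : 0 < l := hμ.trans_le hμl
  obtain ⟨y', hy', hdist⟩ := exists_argmax_near hl hμ hf ho hp (x + h) y
  have h1 : 2 * μ * (primal f (x + h) - f (x + h) y) ≤ ‖gradY f (x + h) y‖ ^ 2 :=
    hp.pl_y (x + h) y
  have h2 : ‖gradY f (x + h) y‖ ≤ l * ‖h‖ := by
    have := hf.gradY_le (x + h) x y y
    rw [gradY_eq_zero ho hy] at this
    simpa using this
  have h3 : ‖y - y'‖ ^ 2 ≤ (3 / 2 * (l / μ) * ‖h‖) ^ 2 := by
    have h4 : ‖gradY f (x + h) y‖ ^ 2 ≤ (l * ‖h‖) ^ 2 := pow_le_pow_left₀ (norm_nonneg _) h2 2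
    calc ‖y - y'‖ ^ 2 ≤ 3 / μ * (primal f (x + h) - f (x + h) y) := hdist
      _ = 3 / (2 * μ ^ 2) * (2 * μ * (primal f (x + h) - f (x + h) y)) := by field_simp
      _ ≤ 3 / (2 * μ ^ 2) * (l * ‖h‖) ^ 2 := by gcongr; exact h1.trans h4
      _ = 3 / 2 * ((l / μ) * ‖h‖) ^ 2 := by field_simp
      _ ≤ _ := by nlinarith [sq_nonneg ((l / μ) * ‖h‖)]
  have h4 : ‖y - y'‖ ≤ 3 / 2 * (l / μ) * ‖h‖ := by
    refine le_of_sq_le_sq h3 (by positivity)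
  have h5 := le_quadratic (fun x => hf.hasGradientAt_x x y') (hf.lipschitz_x y') x h
  have h6 := ho.le_primal x y'
  have h7 : inner ℝ (gradX f x y') h ≤ inner ℝ (gradX f x y) h + l * ‖y - y'‖ * ‖h‖ := by
    have h8 := real_inner_le_norm (gradX f x y' - gradX f x y) h
    have h9 : ‖gradX f x y' - gradX f x y‖ ≤ l * ‖y - y'‖ := by
      have := hf.gradX_le x x y' y
      rw [norm_sub_rev y' y] at this
      simpa using this
    rw [inner_sub_left] at h8
    nlinarith [mul_le_mul_of_nonneg_right h9 (norm_nonneg h)]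
  have h8 : l * ‖y - y'‖ * ‖h‖ ≤ 3 / 2 * l * (l / μ) * ‖h‖ ^ 2 := by
    calc l * ‖y - y'‖ * ‖h‖ ≤ l * (3 / 2 * (l / μ) * ‖h‖) * ‖h‖ := by gcongr
      _ = _ := by ring
  have h9 : l / 2 * ‖h‖ ^ 2 ≤ 1 / 2 * l * (l / μ) * ‖h‖ ^ 2 := by
    have : 1 ≤ l / μ := (one_le_div hμ).2 hμl
    have h10 : l * 1 ≤ l * (l / μ) := by gcongr
    nlinarith [sq_nonneg ‖h‖]
  rw [hy'] at h5
  linarith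

/-- The primal function satisfies the Polyak-Łojasiewicz inequality. -/
theorem primal_pl (hμ : 0 < μ) (ho : OptimaExist f) (hp : TwoSidedPL μ μ f) {x : E d₁} {y : E d₂}
    (hy : f x y = primal f x) : 2 * μ * (primal f x - primalMin f) ≤ ‖gradX f x y‖ ^ 2 := by
  refine le_trans ?_ (hp.pl_x x y)
  have := ho.iInf_le_primalMin y
  rw [hy]
  gcongr

end Objective

/-! ### Variance-reduced gradient estimators -/

section Estimator

variable {n : ℕ} {V : Type*} [NormedAddCommGroup V] [InnerProductSpace ℝ V]

theorem mean_mono {φ ψ : Fin n → ℝ} (h : ∀ i, φ i ≤ ψ i) : mean φ ≤ mean ψ := by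
  unfold mean
  gcongr with i
  exact h i

theorem mean_affine [NeZero n] (a b c : ℝ) (φ ψ : Fin n → ℝ) :
    mean (fun i => a + b * φ i + c * ψ i) = a + b * mean φ + c * mean ψ := by
  have hn : (n : ℝ) ≠ 0 := Nat.cast_ne_zero.2 (NeZero.ne n)
  simp only [mean, Finset.sum_add_distrib, ← Finset.mul_sum, Finset.sum_const, Finset.card_univ,
    Fintype.card_fin, nsmul_eq_mul]
  field_simp

theorem mean_inner (w : V) (v : Fin n → V) :
    mean (fun i => inner ℝ w (v i)) = inner ℝ w ((1 / (n : ℝ)) • ∑ i, v i) := by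
  rw [mean, inner_smul_right, inner_sum]

theorem inv_smul_sum_add_const [NeZero n] (v : Fin n → V) (m : V) :
    (1 / (n : ℝ)) • ∑ i, (v i + m) = (1 / (n : ℝ)) • ∑ i, v i + m := by
  have hn : (n : ℝ) ≠ 0 := Nat.cast_ne_zero.2 (NeZero.ne n)
  rw [Finset.sum_add_distrib, smul_add, Finset.sum_const, Finset.card_univ, Fintype.card_fin,
    ← Nat.cast_smul_eq_nsmul ℝ, smul_smul, one_div_mul_cancel hn, one_smul]

/-- The variance-reduced estimator is unbiased, and its variance is at most the mean squared
deviation from the snapshot. -/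
theorem mean_estimator_le [NeZero n] (v v' : Fin n → V) {S q : ℝ} (hq : 0 ≤ q)
    (hS : ∀ i, ‖v i - v' i‖ ^ 2 ≤ S) (A : ℝ) (w : V) :
    mean (fun i => A + inner ℝ w (v i - v' i + (1 / (n : ℝ)) • ∑ i, v' i) +
      q * ‖v i - v' i + (1 / (n : ℝ)) • ∑ i, v' i‖ ^ 2) ≤
    A + inner ℝ w ((1 / (n : ℝ)) • ∑ i, v i) + q * (‖(1 / (n : ℝ)) • ∑ i, v i‖ ^ 2 + S) := by
  set m' := (1 / (n : ℝ)) • ∑ i, v' i with hm'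
  set m := (1 / (n : ℝ)) • ∑ i, v i with hm
  have hdiff : (1 / (n : ℝ)) • ∑ i, (v i - v' i) = m - m' := by
    rw [Finset.sum_sub_distrib, smul_sub]
  have h1 : mean (fun i => inner ℝ w (v i - v' i + m')) = inner ℝ w m := by
    rw [mean_inner, inv_smul_sum_add_const, hdiff, sub_add_cancel]
  have h2 : mean (fun i => ‖v i - v' i + m'‖ ^ 2) ≤ ‖m‖ ^ 2 + S := by
    calc mean (fun i => ‖v i - v' i + m'‖ ^ 2)
        ≤ mean (fun i => (S + ‖m'‖ ^ 2) + 2 * inner ℝ m' (v i - v' i) + 0 * 0) := by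
          refine mean_mono fun i => ?_
          rw [norm_add_sq_real, real_inner_comm]
          linarith [hS i]
      -- This equals S + ‖m‖² - ‖m - m'‖².
      _ = S + ‖m'‖ ^ 2 + 2 * inner ℝ m' (m - m') := by
          rw [mean_affine, mean_inner, hdiff, zero_mul, add_zero]
      _ ≤ ‖m‖ ^ 2 + S := by
          have := norm_sub_sq_real m m'
          rw [inner_sub_right, real_inner_self_eq_norm_sq]
          rw [real_inner_comm] at this
          nlinarith [sq_nonneg ‖m - m'‖]
  have h3 := mean_affine A 1 q (fun i => inner ℝ w (v i - v' i + m'))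
    (fun i => ‖v i - v' i + m'‖ ^ 2)
  simp only [one_mul] at h3
  rw [h3, h1]
  gcongr

end Estimator

/-! ### Expected effect of the y-update and of the x-update. -/

section Step

variable {n d₁ d₂ : ℕ} [NeZero n] {F : Fin n → E d₁ → E d₂ → ℝ} {l μ : ℝ}

/-- Young's inequality from ‖θx - τp‖² ≥ 0. It splits the drift of the distance to the snapshot into
relative growth θ and a multiple of the squared gradient. -/
theorem two_mul_inner_le {V : Type*} [NormedAddCommGroup V] [InnerProductSpace ℝ V] {τ θ : ℝ}
    (hθ : 0 < θ) (x p : V) :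
    2 * τ * inner ℝ x p ≤ θ * ‖x‖ ^ 2 + τ ^ 2 * θ⁻¹ * ‖p‖ ^ 2 := by
  have h : 0 ≤ ‖θ • x - τ • p‖ ^ 2 := sq_nonneg _
  rw [norm_sub_sq_real, norm_smul, norm_smul, mul_pow, mul_pow, inner_smul_left, inner_smul_right,
    Real.norm_eq_abs, Real.norm_eq_abs, sq_abs, sq_abs] at h
  simp only [conj_trivial] at h
  have h2 : θ * (2 * τ * inner ℝ x p) ≤ θ * (θ * ‖x‖ ^ 2 + τ ^ 2 * θ⁻¹ * ‖p‖ ^ 2) := by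
    have : θ * (τ ^ 2 * θ⁻¹ * ‖p‖ ^ 2) = τ ^ 2 * ‖p‖ ^ 2 := by field_simp
    nlinarith
  exact le_of_mul_le_mul_left h2 hθ

theorem sq_le_of_le_mul_add {r l a b : ℝ} (hr : 0 ≤ r) (h : r ≤ l * (a + b)) :
    r ^ 2 ≤ 2 * l ^ 2 * (a ^ 2 + b ^ 2) := by
  have h1 := pow_le_pow_left₀ hr h 2
  nlinarith [mul_nonneg (sq_nonneg l) (sq_nonneg (a - b))]

/-- The ascent term is -(τ/20)‖∇_y f‖². By `hstep`, curvature, second moment and drift use at most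
τ/80 of it; PL converts the remaining 3τ/80 into the decrease of g - f. -/
theorem mean_nextY_le (hμ : 0 < μ) (hμl : μ ≤ l) (hF : ∀ i, LipschitzGradient l (F i))
    (hp : TwoSidedPL μ μ (average F)) {τ θ c : ℝ} (hτ : 0 < τ) (hθ : 0 < θ) (hc : 0 ≤ c)
    (hstep : τ * (l / 40 + c * (1 + θ⁻¹)) ≤ 1 / 80) (w : E d₁ × E d₂) (x : E d₁) (y : E d₂) :
    mean (fun j =>
      gap (average F) (x, nextY F τ w ((1 / (n : ℝ)) • ∑ i, gradY (F i) w.1 w.2) (x, y) j) +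
      c * (‖x - w.1‖ ^ 2 +
        ‖nextY F τ w ((1 / (n : ℝ)) • ∑ i, gradY (F i) w.1 w.2) (x, y) j - w.2‖ ^ 2)) ≤
    (primal (average F) x - primalMin (average F)) +
      (1 / 20 - 3 / 40 * (μ * τ)) * (primal (average F) x - average F x y) +
      c * ‖x - w.1‖ ^ 2 + c * (1 + θ) * ‖y - w.2‖ ^ 2 +
      2 * l ^ 2 * τ ^ 2 * (l / 40 + c) * (‖x - w.1‖ ^ 2 + ‖y - w.2‖ ^ 2) := by
  have hl : 0 < l := hμ.trans_le hμl
  have hf := LipschitzGradient.average hF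
  set f := average F with hfdef
  set r := gradY f x y with hr
  have hr' : r = (1 / (n : ℝ)) • ∑ i, gradY (F i) x y := gradY_average hF x y
  have key := mean_estimator_le (fun i => gradY (F i) x y) (fun i => gradY (F i) w.1 w.2)
    (S := 2 * l ^ 2 * (‖x - w.1‖ ^ 2 + ‖y - w.2‖ ^ 2)) (q := τ ^ 2 * (l / 40 + c)) (by positivity)
    (fun i => sq_le_of_le_mul_add (norm_nonneg _) ((hF i).gradY_le _ _ _ _))
    ((primal f x - primalMin f) + 1 / 20 * (primal f x - f x y) +
      c * (‖x - w.1‖ ^ 2 + ‖y - w.2‖ ^ 2))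
    (-(τ / 20) • r + (2 * c * τ) • (y - w.2))
  refine (mean_mono fun j => ?_).trans (key.trans ?_)
  · simp only [nextY, gap]
    set u := gradY (F j) x y - gradY (F j) w.1 w.2 + (1 / (n : ℝ)) • ∑ i, gradY (F i) w.1 w.2
    have h1 := quadratic_le (hf.hasGradientAt_y x) (hf.lipschitz_y x) y (τ • u)
    have h2 : ‖y + τ • u - w.2‖ ^ 2 =
        ‖y - w.2‖ ^ 2 + 2 * τ * inner ℝ (y - w.2) u + τ ^ 2 * ‖u‖ ^ 2 := by
      have : y + τ • u - w.2 = (y - w.2) + τ • u := by abel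
      rw [this, norm_add_sq_real, inner_smul_right, norm_smul, mul_pow, Real.norm_eq_abs, sq_abs]
      ring
    rw [inner_smul_right, norm_smul, mul_pow, Real.norm_eq_abs, sq_abs] at h1
    rw [h2, inner_add_left, inner_smul_left, inner_smul_left]
    simp only [conj_trivial]
    linarith
  · rw [← hr', inner_add_left, inner_smul_left, inner_smul_left, real_inner_self_eq_norm_sq]
    simp only [conj_trivial]
    have h1 := mul_le_mul_of_nonneg_left (two_mul_inner_le (τ := τ) hθ (y - w.2) r) hc
    have h2 : 2 * μ * (primal f x - f x y) ≤ ‖r‖ ^ 2 := hp.pl_y x y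
    have h3 : τ * (τ * (l / 40 + c * (1 + θ⁻¹))) * ‖r‖ ^ 2 ≤ τ * (1 / 80) * ‖r‖ ^ 2 := by gcongr
    have h4 : 3 / 80 * τ * (2 * μ * (primal f x - f x y)) ≤ 3 / 80 * τ * ‖r‖ ^ 2 := by gcongr
    linarith

/-- Let p be ∇ₓf at y and q the same at a nearby maximizer. The descent term -⟨q, p⟩ is -(‖q‖² +
‖p‖² - ‖q - p‖²)/2: ‖q‖² yields PL for g, ‖p‖² absorbs the second-order terms, and ‖q - p‖² ≤
3(l²/μ)(g - f) is the price of an inexact maximizer. The weight `lam` on g - f is left free so that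
the y-update can be applied afterwards. -/
theorem mean_nextX_le (hμ : 0 < μ) (hμl : μ ≤ l) (hF : ∀ i, LipschitzGradient l (F i))
    (ho : OptimaExist (average F)) (hp : TwoSidedPL μ μ (average F)) {τ θ c lam : ℝ}
    (hτ : 0 < τ) (hθ : 0 < θ) (hc : 0 ≤ c) (hlam : 0 ≤ lam) (hlam' : lam ≤ 1 / 20)
    (hstep : τ * (11 / 5 * l * (l / μ) + c * (1 + θ⁻¹)) ≤ 2 / 5) (w z : E d₁ × E d₂) :
    mean (fun i =>
      (primal (average F) (nextX F τ w ((1 / (n : ℝ)) • ∑ i, gradX (F i) w.1 w.2) z i) -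
        primalMin (average F)) +
      lam * (primal (average F) (nextX F τ w ((1 / (n : ℝ)) • ∑ i, gradX (F i) w.1 w.2) z i) -
        average F (nextX F τ w ((1 / (n : ℝ)) • ∑ i, gradX (F i) w.1 w.2) z i) z.2) +
      c * ‖nextX F τ w ((1 / (n : ℝ)) • ∑ i, gradX (F i) w.1 w.2) z i - w.1‖ ^ 2) ≤
    (1 - τ * μ) * (primal (average F) z.1 - primalMin (average F)) +
      (lam + 63 / 40 * (τ * (l ^ 2 / μ))) * (primal (average F) z.1 - average F z.1 z.2) +
      c * (1 + θ) * ‖z.1 - w.1‖ ^ 2 +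
      2 * l ^ 2 * τ ^ 2 * (11 / 5 * l * (l / μ) + c) *
        (‖z.1 - w.1‖ ^ 2 + ‖z.2 - w.2‖ ^ 2) := by
  obtain ⟨x, y⟩ := z
  have hl : 0 < l := hμ.trans_le hμl
  have hf := LipschitzGradient.average hF
  set f := average F with hfdef
  obtain ⟨ys, hys, hdist⟩ := exists_argmax_near hl hμ hf ho hp x y
  simp only
  set p := gradX f x y with hpdef
  set q := gradX f x ys with hq
  have hp' : p = (1 / (n : ℝ)) • ∑ i, gradX (F i) x y := gradX_average hF x y
  have key := mean_estimator_le (fun i => gradX (F i) x y) (fun i => gradX (F i) w.1 w.2)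
    (S := 2 * l ^ 2 * (‖x - w.1‖ ^ 2 + ‖y - w.2‖ ^ 2))
    (q := τ ^ 2 * (11 / 5 * l * (l / μ) + c)) (by positivity)
    (fun i => sq_le_of_le_mul_add (norm_nonneg _) ((hF i).gradX_le _ _ _ _))
    ((primal f x - primalMin f) + lam * (primal f x - f x y) + c * ‖x - w.1‖ ^ 2)
    (-(τ * (1 + lam)) • q + (τ * lam) • p + (-(2 * c * τ)) • (x - w.1))
  refine (mean_mono fun i => ?_).trans (key.trans ?_)
  · simp only [nextX]
    set u := gradX (F i) x y - gradX (F i) w.1 w.2 + (1 / (n : ℝ)) • ∑ i, gradX (F i) w.1 w.2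
    have hxu : x - τ • u = x + (-τ) • u := by rw [neg_smul, sub_eq_add_neg]
    have h1 := quadratic_le (fun x => hf.hasGradientAt_x x y) (hf.lipschitz_x y) x ((-τ) • u)
    have h2 := primal_le_quadratic hμ hμl hf ho hp hys ((-τ) • u)
    have h3 : ‖x + (-τ) • u - w.1‖ ^ 2 =
        ‖x - w.1‖ ^ 2 - 2 * τ * inner ℝ (x - w.1) u + τ ^ 2 * ‖u‖ ^ 2 := by
      have : x + (-τ) • u - w.1 = (x - w.1) + (-τ) • u := by abel
      rw [this, norm_add_sq_real, inner_smul_right, norm_smul, mul_pow, Real.norm_eq_abs, sq_abs]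
      ring
    rw [inner_smul_right, norm_smul, mul_pow, Real.norm_eq_abs, sq_abs, neg_sq] at h1 h2
    rw [hxu, h3, inner_add_left, inner_add_left, inner_smul_left, inner_smul_left,
      inner_smul_left]
    simp only [conj_trivial]
    have h4 := mul_le_mul_of_nonneg_left h1 hlam
    have h5 := mul_le_mul_of_nonneg_left h2 (by linarith : 0 ≤ 1 + lam)
    -- For lam ≤ 1/20 and κ ≥ 1 the curvatures of g and f add up to at most (2.1 + 0.025) κl.
    have h6 : ((1 + lam) * (2 * l * (l / μ)) + lam * (l / 2)) * (τ ^ 2 * ‖u‖ ^ 2) ≤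
        11 / 5 * l * (l / μ) * (τ ^ 2 * ‖u‖ ^ 2) := by
      gcongr
      have : 1 ≤ l / μ := (one_le_div hμ).2 hμl
      have h7 : l * 1 ≤ l * (l / μ) := by gcongr
      have h8 : lam * (l * (l / μ)) ≤ 1 / 20 * (l * (l / μ)) := by gcongr
      have h9 : lam * l ≤ 1 / 20 * l := by gcongr
      have h10 : 0 < l * (l / μ) := by positivity
      linarith
    linarith
  · rw [← hp', inner_add_left, inner_add_left, inner_smul_left, inner_smul_left, inner_smul_left,
      real_inner_self_eq_norm_sq]
    simp only [conj_trivial]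
    have h1 := mul_le_mul_of_nonneg_left (two_mul_inner_le (τ := -τ) hθ (x - w.1) p) hc
    have h2 : 2 * μ * (primal f x - primalMin f) ≤ ‖q‖ ^ 2 := primal_pl hμ ho hp hys
    have h3 : τ * (τ * (11 / 5 * l * (l / μ) + c * (1 + θ⁻¹))) * ‖p‖ ^ 2 ≤
        τ * (2 / 5) * ‖p‖ ^ 2 := by gcongr
    have h4 : ‖q - p‖ ^ 2 ≤ 3 * (l ^ 2 / μ) * (primal f x - f x y) := by
      have h5 : ‖q - p‖ ≤ l * ‖y - ys‖ := by
        have := hf.gradX_le x x ys y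
        rw [norm_sub_rev ys y] at this
        simpa using this
      calc ‖q - p‖ ^ 2 ≤ (l * ‖y - ys‖) ^ 2 := pow_le_pow_left₀ (norm_nonneg _) h5 2
        _ = l ^ 2 * ‖y - ys‖ ^ 2 := by ring
        _ ≤ l ^ 2 * (3 / μ * (primal f x - f x y)) := by gcongr
        _ = _ := by ring
    have h5 := norm_sub_sq_real q p
    have h6 : inner ℝ q p = (‖q‖ ^ 2 + ‖p‖ ^ 2 - ‖q - p‖ ^ 2) / 2 := by linarith
    rw [h6]
    have h7 : τ * ((1 + lam) / 2) * ‖q - p‖ ^ 2 ≤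
        τ * ((1 + 1 / 20) / 2) * (3 * (l ^ 2 / μ) * (primal f x - f x y)) := by
      gcongr
    have h8 : τ * (1 / 2) * (2 * μ * (primal f x - primalMin f)) ≤
        τ * ((1 + lam) / 2) * ‖q‖ ^ 2 := by
      have h9 : τ * (1 / 2) * (2 * μ * (primal f x - primalMin f)) ≤ τ * (1 / 2) * ‖q‖ ^ 2 := by
        gcongr
      have h10 : 0 ≤ τ * lam * ‖q‖ ^ 2 := by positivity
      linarith
    have h9 : τ * lam * ‖p‖ ^ 2 ≤ τ * (1 / 20) * ‖p‖ ^ 2 := by gcongr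
    have h10 : 0 ≤ τ * ‖p‖ ^ 2 := by positivity
    linarith

end Step

/-! ### The Lyapunov function and the contraction over an epoch. -/

section Epoch

variable {n d₁ d₂ : ℕ} [NeZero n] {F : Fin n → E d₁ → E d₂ → ℝ} {l μ κ t τ₁ τ₂ : ℝ}

/-- Here c weights the squared distance after the iteration and c' is the weight on the x-distance
between the two updates. With θ = 1/(8N), the drift adds at most (3/8) l t² to the weight and the
noise terms about l t²/8, within the allowed l t². The price is θ⁻¹ = 8N in the first two
conditions, whence the smallness of N²t³. -/
theorem lyapunov_coefficients (hl : 0 < l) (hκ : 1 ≤ κ) (ht : 0 < t) (htu : t ≤ 1 / 10000)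
    (h₁ : τ₁ = t / (28 * κ ^ 2 * l)) (h₂ : τ₂ = t / l) {N k : ℕ} (hk : k < N)
    (hNt : N * t ^ 2 ≤ 1 / 10000) (hNt' : N ^ 2 * t ^ 3 ≤ 1 / 10000) {c c' θ : ℝ}
    (hc : c = l * t ^ 2 * (N + k)) (hc' : c' = c + 2 * l ^ 2 * τ₂ ^ 2 * (l / 40 + c))
    (hθ : θ = 1 / (8 * N)) :
    τ₂ * (l / 40 + c * (1 + θ⁻¹)) ≤ 1 / 80 ∧
    τ₁ * (11 / 5 * l * κ + c' * (1 + θ⁻¹)) ≤ 2 / 5 ∧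
    c' * (1 + θ) + 2 * l ^ 2 * τ₁ ^ 2 * (11 / 5 * l * κ + c') ≤ l * t ^ 2 * (N + (k + 1)) := by
  have hN1 : (1 : ℝ) ≤ N := by exact_mod_cast (by omega : 1 ≤ N)
  have hkN : (k : ℝ) ≤ N := by exact_mod_cast hk.le
  have hθi : θ⁻¹ = 8 * N := by rw [hθ, one_div, inv_inv]
  set s : ℝ := t ^ 2 * (N + k) with hs
  have hs0 : 0 ≤ s := by positivity
  have hs2 : s ≤ 2 * (N * t ^ 2) := by
    calc s ≤ t ^ 2 * (N + N) := mul_le_mul_of_nonneg_left (by linarith) (by positivity)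
      _ = _ := by ring
  have hcs : c = l * s := by rw [hc]; ring
  have hlτ₂ : l * τ₂ = t := by rw [h₂]; field_simp
  have hlτ₁ : l * τ₁ = t / (28 * κ ^ 2) := by rw [h₁]; field_simp
  have hκ2 : 1 ≤ κ ^ 2 := one_le_pow₀ hκ
  set e : ℝ := s + t ^ 2 * (1 / 20 + 2 * s) with he
  have hce : c' = l * e := by
    have : l ^ 2 * τ₂ ^ 2 = t ^ 2 := by rw [← mul_pow, hlτ₂]
    rw [hc', hcs, he, mul_assoc 2, this]
    ring
  have he0 : 0 ≤ e := by positivity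
  have ht2 : t ^ 2 ≤ N * t ^ 2 := le_mul_of_one_le_left (by positivity) hN1
  have he3 : e ≤ 3 * (N * t ^ 2) := by
    have : t ^ 2 * (1 / 20 + 2 * s) ≤ t ^ 2 * (1 / 20 + 2 * (2 * (1 / 10000))) := by
      gcongr
      linarith
    linarith
  have h19 : (1 : ℝ) + 8 * N ≤ 9 * N := by linarith
  refine ⟨?_, ?_, ?_⟩
  · rw [hθi, hcs]
    have h3 : t * (s * (1 + 8 * N)) ≤ t * (2 * (N * t ^ 2) * (9 * N)) := by gcongr
    calc τ₂ * (l / 40 + l * s * (1 + 8 * N)) = l * τ₂ * (1 / 40 + s * (1 + 8 * N)) := by ring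
      _ = t / 40 + t * (s * (1 + 8 * N)) := by rw [hlτ₂]; ring
      _ ≤ 1 / 80 := by linarith
  · rw [hθi, hce]
    have h3 : t * (e * (1 + 8 * N)) ≤ t * (3 * (N * t ^ 2) * (9 * N)) := by gcongr
    calc τ₁ * (11 / 5 * l * κ + l * e * (1 + 8 * N))
        = l * τ₁ * (11 / 5 * κ + e * (1 + 8 * N)) := by ring
      _ ≤ l * τ₁ * (11 / 5 * κ ^ 2 + e * (1 + 8 * N) * κ ^ 2) := by
          rw [hlτ₁]
          have h4 : κ ≤ κ ^ 2 := by nlinarith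
          have h5 : e * (1 + 8 * N) ≤ e * (1 + 8 * N) * κ ^ 2 :=
            le_mul_of_one_le_right (by positivity) hκ2
          gcongr
      _ = 1 / 28 * (11 / 5 * t + t * (e * (1 + 8 * N))) := by
          rw [hlτ₁]
          field_simp
      _ ≤ 2 / 5 := by linarith
  · rw [hce]
    have h3 : e * θ ≤ 3 / 8 * t ^ 2 := by
      calc e * θ ≤ 3 * (N * t ^ 2) * (1 / (8 * N)) := by rw [hθ]; gcongr
        _ = 3 / 8 * t ^ 2 := by field_simp
    have h4 : (l * τ₁) ^ 2 * (11 / 5 * κ + e) ≤ t ^ 2 * (1 / 100) := by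
      have h5 : 11 / 5 * κ + e ≤ 3 * κ ^ 4 := by
        have h6 : κ ≤ κ ^ 4 := le_self_pow₀ hκ (by norm_num)
        have h7 : 1 ≤ κ ^ 4 := one_le_pow₀ hκ
        linarith
      calc (l * τ₁) ^ 2 * (11 / 5 * κ + e) ≤ (t / (28 * κ ^ 2)) ^ 2 * (3 * κ ^ 4) := by
            rw [hlτ₁]; gcongr
        _ = t ^ 2 * (3 / 784) := by field_simp; norm_num
        _ ≤ t ^ 2 * (1 / 100) := mul_le_mul_of_nonneg_left (by norm_num) (by positivity)
    have h5 : t ^ 2 * (1 / 20 + 2 * s) ≤ t ^ 2 * (1 / 10) := by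
      gcongr
      linarith
    have h6 : s + t ^ 2 = t ^ 2 * (N + (k + 1)) := by rw [hs]; ring
    calc l * e * (1 + θ) + 2 * l ^ 2 * τ₁ ^ 2 * (11 / 5 * l * κ + l * e)
        = l * (e + e * θ + 2 * ((l * τ₁) ^ 2 * (11 / 5 * κ + e))) := by ring
      _ ≤ l * (s + t ^ 2) := by
          refine mul_le_mul_of_nonneg_left ?_ hl.le
          have : 0 ≤ t ^ 2 := by positivity
          linarith
      _ = _ := by rw [h6]; ring

/-- One inner iteration decreases the Lyapunov function. -/
theorem mean_lyapunov_le (hμ : 0 < μ) (hκ : 1 ≤ κ) (hl : l = κ * μ)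
    (hF : ∀ i, LipschitzGradient l (F i)) (ho : OptimaExist (average F))
    (hp : TwoSidedPL μ μ (average F)) (ht : 0 < t) (htu : t ≤ 1 / 10000)
    (h₁ : τ₁ = t / (28 * κ ^ 2 * l)) (h₂ : τ₂ = t / l) {N k : ℕ} (hk : k < N)
    (hNt : N * t ^ 2 ≤ 1 / 10000) (hNt' : N ^ 2 * t ^ 3 ≤ 1 / 10000) (w z : E d₁ × E d₂) :
    (τ₁ * μ) * gap (average F) z + (mean fun i => mean fun j =>
      gap (average F) (nextX F τ₁ w ((1 / (n : ℝ)) • ∑ i, gradX (F i) w.1 w.2) z i,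
        nextY F τ₂ w ((1 / (n : ℝ)) • ∑ i, gradY (F i) w.1 w.2)
          (nextX F τ₁ w ((1 / (n : ℝ)) • ∑ i, gradX (F i) w.1 w.2) z i, z.2) j) +
      l * t ^ 2 * (N + k) *
        (‖nextX F τ₁ w ((1 / (n : ℝ)) • ∑ i, gradX (F i) w.1 w.2) z i - w.1‖ ^ 2 +
          ‖nextY F τ₂ w ((1 / (n : ℝ)) • ∑ i, gradY (F i) w.1 w.2)
            (nextX F τ₁ w ((1 / (n : ℝ)) • ∑ i, gradX (F i) w.1 w.2) z i, z.2) j - w.2‖ ^ 2)) ≤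
    gap (average F) z +
      l * t ^ 2 * (N + (k + 1)) * (‖z.1 - w.1‖ ^ 2 + ‖z.2 - w.2‖ ^ 2) := by
  have hκ0 : 0 < κ := by linarith
  have hl0 : 0 < l := by rw [hl]; positivity
  have hμl : μ ≤ l := by rw [hl]; exact le_mul_of_one_le_left hμ.le hκ
  have hlμ : l / μ = κ := by rw [hl]; field_simp
  have hN0 : (0 : ℝ) < N := by exact_mod_cast (by omega : 0 < N)
  have hτ₁ : 0 < τ₁ := by rw [h₁]; positivity
  have hτ₂ : 0 < τ₂ := by rw [h₂]; positivity
  obtain ⟨c, hc⟩ : ∃ c, c = l * t ^ 2 * (N + k) := ⟨_, rfl⟩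
  obtain ⟨θ, hθ⟩ : ∃ θ, θ = 1 / (8 * (N : ℝ)) := ⟨_, rfl⟩
  obtain ⟨ν, hν⟩ : ∃ ν, ν = 2 * l ^ 2 * τ₂ ^ 2 * (l / 40 + c) := ⟨_, rfl⟩
  have hc0 : 0 ≤ c := by rw [hc]; positivity
  have hθ0 : 0 < θ := by rw [hθ]; positivity
  have hν0 : 0 ≤ ν := by rw [hν]; positivity
  obtain ⟨hs₂, hs₁, hcoef⟩ := lyapunov_coefficients hl0 hκ ht htu h₁ h₂ hk hNt hNt' hc
    (c' := c + ν) (by rw [hν]) hθ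
  have hm : μ * τ₂ = 28 * κ ^ 2 * (τ₁ * μ) := by rw [h₁, h₂]; field_simp
  have hm' : τ₁ * (l ^ 2 / μ) = κ ^ 2 * (τ₁ * μ) := by rw [hl]; field_simp
  have hm1 : μ * τ₂ ≤ 1 / 10000 := by
    have : μ * τ₂ = t / κ := by rw [h₂, hl]; field_simp
    rw [this]
    exact (div_le_self ht.le hκ).trans htu
  have hm2 : 0 ≤ μ * τ₂ := by positivity
  rw [← hc]
  have hX := mean_nextX_le hμ hμl hF ho hp hτ₁ hθ0 (add_nonneg hc0 hν0)
    (lam := 1 / 20 - 3 / 40 * (μ * τ₂)) (by linarith) (by linarith) (by rw [hlμ]; exact hs₁) w z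
  have hY := fun x => mean_nextY_le hμ hμl hF hp hτ₂ hθ0 hc0 hs₂ w x z.2
  -- The y-bound holds for each value of the updated x, so it can be averaged over the first index.
  -- Its right side is `Φ i`, the quantity averaged in `mean_nextX_le`, plus a term independent of
  -- i.
  have hcomb := mean_mono fun i =>
    hY (nextX F τ₁ w ((1 / (n : ℝ)) • ∑ i, gradX (F i) w.1 w.2) z i)
  set Φ : Fin n → ℝ := fun i =>
      (primal (average F) (nextX F τ₁ w ((1 / (n : ℝ)) • ∑ i, gradX (F i) w.1 w.2) z i) -
        primalMin (average F)) +
      (1 / 20 - 3 / 40 * (μ * τ₂)) *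
        (primal (average F) (nextX F τ₁ w ((1 / (n : ℝ)) • ∑ i, gradX (F i) w.1 w.2) z i) -
        average F (nextX F τ₁ w ((1 / (n : ℝ)) • ∑ i, gradX (F i) w.1 w.2) z i) z.2) +
      (c + ν) * ‖nextX F τ₁ w ((1 / (n : ℝ)) • ∑ i, gradX (F i) w.1 w.2) z i - w.1‖ ^ 2 with hΦ
  have haff := mean_affine ((c * (1 + θ) + ν) * ‖z.2 - w.2‖ ^ 2) 1 0 Φ (fun _ => 0)
  have hle : mean (fun i => (c * (1 + θ) + ν) * ‖z.2 - w.2‖ ^ 2 + 1 * Φ i + 0 * 0) =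
      mean _ := congrArg mean (funext fun i => by
        show _ = (primal (average F)
            (nextX F τ₁ w ((1 / (n : ℝ)) • ∑ i, gradX (F i) w.1 w.2) z i) -
              primalMin (average F)) +
          (1 / 20 - 3 / 40 * (μ * τ₂)) *
            (primal (average F) (nextX F τ₁ w ((1 / (n : ℝ)) • ∑ i, gradX (F i) w.1 w.2) z i) -
              average F (nextX F τ₁ w ((1 / (n : ℝ)) • ∑ i, gradX (F i) w.1 w.2) z i) z.2) +
          c * ‖nextX F τ₁ w ((1 / (n : ℝ)) • ∑ i, gradX (F i) w.1 w.2) z i - w.1‖ ^ 2 +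
          c * (1 + θ) * ‖z.2 - w.2‖ ^ 2 +
          2 * l ^ 2 * τ₂ ^ 2 * (l / 40 + c) *
            (‖nextX F τ₁ w ((1 / (n : ℝ)) • ∑ i, gradX (F i) w.1 w.2) z i - w.1‖ ^ 2 +
              ‖z.2 - w.2‖ ^ 2)
        rw [hΦ, ← hν]
        ring)
  rw [hle] at haff
  rw [haff] at hcomb
  have hκ2 : 1 ≤ κ ^ 2 := one_le_pow₀ hκ
  have hb : 0 ≤ primal (average F) z.1 - average F z.1 z.2 := sub_nonneg.2 (ho.le_primal _ _)
  -- In units of κ²τ₁μ the y-update gains 28 · 3/40 = 2.1 and the x-update loses 63/40 = 1.575; the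
  -- surplus exceeds the required 1/20.
  have hb' : 1 / 20 - 3 / 40 * (μ * τ₂) + 63 / 40 * (τ₁ * (l ^ 2 / μ)) ≤
      1 / 20 * (1 - τ₁ * μ) := by
    have : τ₁ * μ ≤ κ ^ 2 * (τ₁ * μ) := le_mul_of_one_le_left (by positivity) hκ2
    rw [hm, hm']
    linarith
  have hgap := mul_le_mul_of_nonneg_right hb' hb
  rw [hlμ] at hX
  have hXc := mul_le_mul_of_nonneg_right hcoef (sq_nonneg ‖z.1 - w.1‖)
  have hYc := mul_le_mul_of_nonneg_right hcoef (sq_nonneg ‖z.2 - w.2‖)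
  -- The y-distance carries weight c(1 + θ) + ν before the x-update, short of (c + ν)(1 + θ) by this
  -- slack.
  have hνθ : 0 ≤ ν * θ * ‖z.2 - w.2‖ ^ 2 := by positivity
  refine (add_le_add_right hcomb _).trans ?_
  unfold gap
  linarith

theorem expect_epoch_gap_le (hμ : 0 < μ) (hκ : 1 ≤ κ) (hl : l = κ * μ)
    (hF : ∀ i, LipschitzGradient l (F i)) (ho : OptimaExist (average F))
    (hp : TwoSidedPL μ μ (average F)) (ht : 0 < t) (htu : t ≤ 1 / 10000)
    (h₁ : τ₁ = t / (28 * κ ^ 2 * l)) (h₂ : τ₂ = t / l) {N : ℕ} (hN : 1 ≤ N)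
    (hNt : N * t ^ 2 ≤ 1 / 10000) (hNt' : N ^ 2 * t ^ 3 ≤ 1 / 10000)
    (hprog : 2 ≤ N * (τ₁ * μ)) (w : E d₁ × E d₂) (c : ℕ) :
    expect (epoch F τ₁ τ₂ N 1 w c) (fun r => gap (average F) r.1) ≤
      1 / 2 * gap (average F) w := by
  have hκ0 : 0 < κ := by linarith
  have hl0 : 0 < l := by rw [hl]; positivity
  have hτ₁ : 0 < τ₁ := by rw [h₁]; positivity
  have hN0 : (0 : ℝ) < N := by exact_mod_cast hN
  have h := expect_epoch_le F τ₁ τ₂ N hN w c (fun z => (τ₁ * μ) * gap (average F) z)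
    -- With k iterations remaining, the weight falls from 2N to N in units of l t². At the snapshot
    -- `w` itself only `gap` survives.
    (fun k z => gap (average F) z + l * t ^ 2 * (N + k) * (‖z.1 - w.1‖ ^ 2 + ‖z.2 - w.2‖ ^ 2))
    (fun z => add_nonneg (ho.gap_nonneg z) (by positivity))
    (fun k hk z => by
      have := mean_lyapunov_le hμ hκ hl hF ho hp ht htu h₁ h₂ hk hNt hNt' w z
      simpa using this)
  rw [expect_const_mul] at h
  simp only [sub_self, norm_zero, ne_eq, OfNat.ofNat_ne_zero, not_false_eq_true, zero_pow,
    add_zero, mul_zero] at h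
  have hg := ho.gap_nonneg w
  have hx : N * (τ₁ * μ) * expect (epoch F τ₁ τ₂ N 1 w c) (fun r => gap (average F) r.1) ≤
      gap (average F) w := by
    have := mul_le_mul_of_nonneg_left h hN0.le
    rwa [← mul_assoc, ← mul_assoc (N : ℝ) (1 / (N : ℝ)), mul_one_div_cancel hN0.ne', one_mul] at this
  by_contra! hlt
  have h3 := mul_le_mul_of_nonneg_right hprog ((mul_nonneg (by norm_num) hg).trans hlt.le)
  linarith

end Epoch

/-! ### The parameters -/

/-- With β = 10⁻⁹ and α = 168 β^(-1/3), the prefactor is 168/β. The divisor lies between 2 and 5/2,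
giving 84 above and 67.2 below; lowering 67.2 to 56 absorbs the loss of the floor. -/
theorem innerCount_bounds {κ : ℝ} (hκ : 1 ≤ κ) :
    56 * (10 : ℝ) ^ 9 * κ ^ 9 ≤
      innerCount (168 * ((10 : ℝ) ^ 9)⁻¹ ^ (-(1 / 3) : ℝ)) ((10 : ℝ) ^ 9)⁻¹ κ ∧
    (innerCount (168 * ((10 : ℝ) ^ 9)⁻¹ ^ (-(1 / 3) : ℝ)) ((10 : ℝ) ^ 9)⁻¹ κ : ℝ) ≤
      84 * (10 : ℝ) ^ 9 * κ ^ 9 := by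
  have hκ9 : 1 ≤ κ ^ 9 := one_le_pow₀ hκ
  have hpow : 168 * ((10 : ℝ) ^ 9)⁻¹ ^ (-(1 / 3) : ℝ) * ((10 : ℝ) ^ 9)⁻¹ ^ (-(2 / 3) : ℝ) =
      168 * 10 ^ 9 := by
    rw [mul_assoc, ← Real.rpow_add (by positivity)]
    norm_num [Real.rpow_neg_one]
  have hroot : ((10 : ℝ) ^ 9)⁻¹ ^ (1 / 2 : ℝ) ≤ 1 / 8 := by
    rw [← Real.sqrt_eq_rpow]
    exact Real.sqrt_le_iff.2 ⟨by norm_num, by norm_num⟩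
  have hroot0 : 0 ≤ ((10 : ℝ) ^ 9)⁻¹ ^ (1 / 2 : ℝ) := by positivity
  unfold innerCount
  rw [hpow]
  set δ : ℝ := 4 * ((10 : ℝ) ^ 9)⁻¹ ^ (1 / 2 : ℝ) * (κ ^ 3)⁻¹ with hδ
  have hδ0 : 0 ≤ δ := by positivity
  have hδ1 : δ ≤ 1 / 2 := by
    have : (κ ^ 3)⁻¹ ≤ 1 := inv_le_one_of_one_le₀ (one_le_pow₀ hκ)
    calc δ ≤ 4 * (1 / 8) * 1 := by rw [hδ]; gcongr
      _ = 1 / 2 := by norm_num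
  constructor
  · have h1 := Nat.sub_one_lt_floor (168 * (10 : ℝ) ^ 9 * κ ^ 9 * (2 + δ)⁻¹)
    have h2 : 168 * (10 : ℝ) ^ 9 * κ ^ 9 * (5 / 2)⁻¹ ≤
        168 * (10 : ℝ) ^ 9 * κ ^ 9 * (2 + δ)⁻¹ := by
      gcongr
      linarith
    norm_num at h1 h2 ⊢
    linarith
  · refine (Nat.floor_le (by positivity)).trans ?_
    have h2 : 168 * (10 : ℝ) ^ 9 * κ ^ 9 * (2 + δ)⁻¹ ≤ 168 * (10 : ℝ) ^ 9 * κ ^ 9 * 2⁻¹ := by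
      gcongr
      linarith
    linarith

theorem potential_eq_zero {n d₁ d₂ : ℕ} [NeZero n] {F : Fin n → E d₁ → E d₂ → ℝ} {τ₁ τ₂ : ℝ}
    {N : ℕ} (h : ∀ x y x' y', average F x y = average F x' y') (z : E d₁ × E d₂) (k : ℕ) :
    potential F τ₁ τ₂ N 1 z k = 0 := by
  have h1 : ∀ x, primal (average F) x = average F 0 0 := by
    intro x
    unfold primal
    simp only [fun y => h x y 0 0, ciSup_const]
  have h2 : primalMin (average F) = average F 0 0 := by
    unfold primalMin
    simp only [h1, ciInf_const]
  have h3 : (fun r : (E d₁ × E d₂) × ℕ => gap (average F) r.1) = fun _ => 0 := by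
    funext r
    simp [gap, h1, h2, h r.1.1 r.1.2 0 0]
  rw [potential_eq, h3, expect_const _ _ (law_support_finite _ _ _ _ _ _)]

theorem potential_zero {n d₁ d₂ : ℕ} [NeZero n] (F : Fin n → E d₁ → E d₂ → ℝ) (τ₁ τ₂ : ℝ)
    (N : ℕ) (z : E d₁ × E d₂) : potential F τ₁ τ₂ N 1 z 0 = gap (average F) z := by
  rw [potential_eq, law_zero, expect_pure]

/-- A sequence that is halved at each step is at most `ε` after logarithmically many steps. -/
theorem exists_le_of_halving {p : ℕ → ℝ} (h0 : 0 ≤ p 0) (hp : ∀ k, p (k + 1) ≤ 1 / 2 * p k)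
    {ε : ℝ} (hε : 0 < ε) :
    ∃ K : ℕ, p K ≤ ε ∧ (K : ℝ) ≤ 2 * (1 + Real.posLog (p 0 / ε)) := by
  have hpow : ∀ k, p k * 2 ^ k ≤ p 0 := by
    intro k
    induction k with
    | zero => simp
    | succ k ih =>
      refine le_trans ?_ ih
      calc p (k + 1) * 2 ^ (k + 1) ≤ 1 / 2 * p k * 2 ^ (k + 1) := by gcongr; exact hp k
        _ = p k * 2 ^ k := by ring
  set L := Real.posLog (p 0 / ε) with hL
  have hL0 : 0 ≤ L := Real.posLog_nonneg
  have hlog : 1 / 2 < Real.log 2 := by linarith [Real.log_two_gt_d9]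
  refine ⟨⌈L / Real.log 2⌉₊, ?_, ?_⟩
  · set K := ⌈L / Real.log 2⌉₊ with hK
    have h1 : L ≤ K * Real.log 2 := by
      rw [← div_le_iff₀ (by linarith)]
      exact Nat.le_ceil _
    have h2 : p 0 / ε ≤ 2 ^ K := by
      rcases h0.eq_or_lt with h | h
      · rw [← h, zero_div]
        positivity
      · have h3 : Real.log (p 0 / ε) ≤ Real.log (2 ^ K) := by
          rw [Real.log_pow]
          exact (le_max_right _ _).trans h1
        exact (Real.log_le_log_iff (by positivity) (by positivity)).1 h3
    rw [div_le_iff₀ hε] at h2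
    have h3 := (hpow K).trans h2
    rw [mul_comm] at h3
    exact le_of_mul_le_mul_left h3 (by positivity)
  · have h1 := Nat.ceil_lt_add_one (div_nonneg hL0 (by linarith : 0 ≤ Real.log 2))
    have h2 : L / Real.log 2 ≤ 2 * L := by
      rw [div_le_iff₀ (by linarith)]
      nlinarith
    linarith

end VRAGDA

end

/-! ### Choice of the constants and assembly. -/

theorem theorem4 :
    ∃ α β C : ℝ, 0 < α ∧ 0 < β ∧ 0 < C ∧
      ∀ (n d₁ d₂ : ℕ) [NeZero n] (F : Fin n → VRAGDA.E d₁ → VRAGDA.E d₂ → ℝ) (l μ₁ μ₂ κ : ℝ),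
        0 < l → 0 < μ₁ → 0 < μ₂ → κ = l / min μ₁ μ₂ →
        (∀ i, VRAGDA.LipschitzGradient l (F i)) →
        VRAGDA.OptimaExist (VRAGDA.average F) →
        VRAGDA.TwoSidedPL μ₁ μ₂ (VRAGDA.average F) →
        ∀ (τ₁ τ₂ : ℝ) (N : ℕ),
          τ₁ = VRAGDA.stepX β l κ → τ₂ = VRAGDA.stepY β l κ → N = VRAGDA.innerCount α β κ →
          -- the inner loop is not empty (unless the objective is constant)
          ((∃ x y x' y', VRAGDA.average F x y ≠ VRAGDA.average F x' y') → 1 ≤ N) ∧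
          ∀ z : VRAGDA.E d₁ × VRAGDA.E d₂,
            -- every epoch halves the potential
            (∀ k : ℕ, VRAGDA.potential F τ₁ τ₂ N 1 z (k + 1) ≤
              (1 / 2) * VRAGDA.potential F τ₁ τ₂ N 1 z k) ∧
            -- total number of component gradients to reach an `ε`-optimal solution
            (∀ ε : ℝ, 0 < ε → ∃ K : ℕ,
              VRAGDA.potential F τ₁ τ₂ N 1 z K ≤ ε ∧
              ∀ w ∈ (VRAGDA.law F τ₁ τ₂ N 1 z K).support,
                (w.2 : ℝ) ≤ C * ((n : ℝ) + κ ^ 9) *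
                  (1 + Real.posLog (VRAGDA.potential F τ₁ τ₂ N 1 z 0 / ε))) := by
  refine ⟨168 * ((10 : ℝ) ^ 9)⁻¹ ^ (-(1 / 3) : ℝ), ((10 : ℝ) ^ 9)⁻¹, 672 * 10 ^ 9,
    by positivity, by positivity, by positivity, ?_⟩
  intro n d₁ d₂ _ F l μ₁ μ₂ κ hl hμ₁ hμ₂ hκ hF ho hp τ₁ τ₂ N h₁ h₂ hN
  have hμ : 0 < min μ₁ μ₂ := lt_min hμ₁ hμ₂
  have hp' := hp.mono ho (min_le_left μ₁ μ₂) (min_le_right μ₁ μ₂)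
  by_cases hne : ∃ x y x' y', VRAGDA.average F x y ≠ VRAGDA.average F x' y'
  · set μ := min μ₁ μ₂ with hμdef
    have hμl : μ ≤ l := hp'.le_of_ne hl (VRAGDA.LipschitzGradient.average hF) ho hne
    have hκ1 : 1 ≤ κ := by rw [hκ]; exact (one_le_div hμ).2 hμl
    have hκ0 : 0 < κ := by linarith
    have hlκ : l = κ * μ := by rw [hκ]; field_simp
    obtain ⟨hNl, hNu⟩ := VRAGDA.innerCount_bounds hκ1
    rw [← hN] at hNl hNu
    have hκ9 : 1 ≤ κ ^ 9 := one_le_pow₀ hκ1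
    have hκ6 : 1 ≤ κ ^ 6 := one_le_pow₀ hκ1
    have hκ3 : 1 ≤ κ ^ 3 := one_le_pow₀ hκ1
    have hN1 : 1 ≤ N := by
      have : (1 : ℝ) ≤ N := by linarith
      exact_mod_cast this
    refine ⟨fun _ => hN1, fun z => ?_⟩
    set t : ℝ := ((10 : ℝ) ^ 9 * κ ^ 6)⁻¹ with ht
    have ht0 : 0 < t := by positivity
    have htu : t ≤ 1 / 10000 := by
      rw [ht, one_div]
      gcongr
      linarith
    have hNt : N * t ^ 2 ≤ 1 / 10000 := by
      calc N * t ^ 2 ≤ 84 * 10 ^ 9 * κ ^ 9 * t ^ 2 := by gcongr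
        _ = 84 / 10 ^ 9 * (κ ^ 3)⁻¹ := by rw [ht]; field_simp
        _ ≤ 84 / 10 ^ 9 * 1 := by gcongr; exact inv_le_one_of_one_le₀ hκ3
        _ ≤ 1 / 10000 := by norm_num
    have hNt' : N ^ 2 * t ^ 3 ≤ 1 / 10000 := by
      calc N ^ 2 * t ^ 3 ≤ (84 * 10 ^ 9 * κ ^ 9) ^ 2 * t ^ 3 := by gcongr
        _ = 84 ^ 2 / 10 ^ 9 := by rw [ht]; field_simp
        _ ≤ 1 / 10000 := by norm_num
    have h₁' : τ₁ = t / (28 * κ ^ 2 * l) := by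
      rw [h₁, ht, VRAGDA.stepX]
      field_simp
    have h₂' : τ₂ = t / l := by
      rw [h₂, ht, VRAGDA.stepY]
      field_simp
    -- τ₁μ = β/(28κ⁹), so the lower bound 56 κ⁹/β on N gives exactly 2.
    have hprog : 2 ≤ N * (τ₁ * μ) := by
      have h3 : τ₁ * μ = (28 * 10 ^ 9 * κ ^ 9)⁻¹ := by
        rw [h₁', ht, hlκ]
        field_simp
      calc (2 : ℝ) = 56 * 10 ^ 9 * κ ^ 9 * (28 * 10 ^ 9 * κ ^ 9)⁻¹ := by field_simp; norm_num
        _ ≤ N * (τ₁ * μ) := by rw [h3]; gcongr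
    have hhalf := VRAGDA.potential_succ_le F τ₁ τ₂ N z (1 / 2) fun w c =>
      VRAGDA.expect_epoch_gap_le hμ hκ1 hlκ hF ho hp' ht0 htu h₁' h₂' hN1 hNt hNt' hprog w c
    refine ⟨hhalf, fun ε hε => ?_⟩
    obtain ⟨K, hK, hKle⟩ := VRAGDA.exists_le_of_halving
      (by rw [VRAGDA.potential_zero]; exact ho.gap_nonneg z) hhalf hε
    refine ⟨K, hK, fun w hw => ?_⟩
    rw [VRAGDA.law_cost F τ₁ τ₂ N z K w hw]
    push_cast
    have hlog : 0 ≤ Real.posLog (VRAGDA.potential F τ₁ τ₂ N 1 z 0 / ε) := Real.posLog_nonneg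
    have hn : (0 : ℝ) ≤ n := n.cast_nonneg
    -- An epoch costs two full gradients and four evaluations per inner iteration; 4 · 84 = 336,
    -- doubled by the bound on K.
    calc (K : ℝ) * (2 * n + 4 * N)
        ≤ 2 * (1 + Real.posLog (VRAGDA.potential F τ₁ τ₂ N 1 z 0 / ε)) *
          (336 * 10 ^ 9 * (n + κ ^ 9)) := by
          gcongr
          linarith
      _ = _ := by ring
  -- For constant f, κ may be below 1 and N may be 0, but the potential vanishes identically and K =
  -- 0 costs nothing.
  · refine ⟨fun h => absurd h hne, fun z => ?_⟩
    push Not at hne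
    simp only [VRAGDA.potential_eq_zero hne]
    refine ⟨fun _ => by norm_num, fun ε hε => ⟨0, hε.le, fun w hw => ?_⟩⟩
    rw [VRAGDA.law_cost F τ₁ τ₂ N z 0 w hw]
    have hκ0 : 0 < κ := by rw [hκ]; positivity
    have hlog : 0 ≤ Real.posLog (0 / ε) := Real.posLog_nonneg
    simp only [zero_mul, Nat.cast_zero]
    positivity
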